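/- Let $\mathcal H_A\otimes\mathcal H_B$ be a bipartite Hilbert space of arbitrary but finite dimension, and let $S(\rho)=-\mathrm{Tr}[\rho\log_2\rho]$ denote the von Neumann entropy. For every $\varepsilon>0$ there exist finite-dimensional Hilbert spaces $\mathcal H_{A'},\mathcal H_{B'}$ and a (not necessarily pure) state $\tau_\varepsilon$ on $\mathcal H_{A'}\otimes\mathcal H_{B'}$ (a universal catalyst) such that for every pair of unit vectors $|\psi\rangle,|\phi\rangle\in\mathcal H_A\otimes\mathcal H_B$ with $S(\psi^A)\ge S(\phi^A)$ there is an LOCC protocol $\Lambda$ on $AA'BB'$, with finitely many rounds, in which Alice holds $AA'$ and Bob holds $BB'$, for which $$\mathrm{Tr}_{AB}\left[\Lambda\left(\psi^{AB}\otimes\tau_\varepsilon\right)\right]=\tau_\varepsilon,\qquad \left\Vert\Lambda\left(\psi^{AB}\otimes\tau_\varepsilon\right)-\phi^{AB}\otimes\tau_\varepsilon\right\Vert_1<\varepsilon .$$ Here $\psi^{AB}=|\psi\rangle\langle\psi|$, $\phi^{AB}=|\phi\rangle\langle\phi|$, $\psi^A=\mathrm{Tr}_B\,\psi^{AB}$,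 $\phi^A=\mathrm{Tr}_B\,\phi^{AB}$, and $\Vert X\Vert_1=\mathrm{Tr}\sqrt{X^\dagger X}$ is the trace norm. An LOCC protocol is a finite sequence of rounds, in each of which one party performs a local measurement with finitely many outcomes, described by Kraus operators $K_i$ with $\sum_i K_i^\dagger K_i=1$ (the $K_i$ may change the dimension of the local system), and announces the outcome to the other party; later measurements may depend on all earlier outcomes. -/

import Mathlib

open scoped Kronecker ComplexOrder

noncomputable section

namespace UniversalCatalysis

open Matrix

/-! Finite-dimensional Hilbert spaces are `ℂ^A` for a finite index type `A`; operators on the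
composite of Alice's system `A` and Bob's system `B` are matrices indexed by `A × B`. -/

/-- Quantum states: positive semidefinite matrices of trace one. -/
def IsDensityMatrix {n : Type*} [Fintype n] (ρ : Matrix n n ℂ) : Prop :=
  ρ.PosSemidef ∧ ρ.trace = 1

/-- The operator `|ψ⟩⟨ψ|` of a vector `ψ`. -/
def ketBra {n : Type*} (ψ : EuclideanSpace ℂ n) : Matrix n n ℂ :=
  Matrix.of fun i j => ψ i * star (ψ j)

/-- The marginal `X^A = Tr_B X` of an operator on `A ⊗ B`. -/
def reduceA {A B : Type*} [Fintype B] (X : Matrix (A × B) (A × B) ℂ) : Matrix A A ℂ :=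
  Matrix.of fun a c => ∑ b, X (a, b) (c, b)

theorem reduceA_ketBra_isHermitian {A B : Type*} [Fintype B] (ψ : EuclideanSpace ℂ (A × B)) :
    (reduceA (ketBra ψ)).IsHermitian := by
  ext a c
  simp [reduceA, ketBra, mul_comm]

/-- The von Neumann entropy `S(ρ) = -Tr[ρ log₂ ρ]`, computed from the eigenvalues of `ρ`
(with `0 log₂ 0 = 0`). -/
def vonNeumannEntropy {n : Type*} [Fintype n] [DecidableEq n] {ρ : Matrix n n ℂ}
    (hρ : ρ.IsHermitian) : ℝ :=
  -∑ i, hρ.eigenvalues i * Real.logb 2 (hρ.eigenvalues i)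

/-- The entropy `S(ψ^A)` of Alice's marginal of the pure state `ψ`. -/
def entanglementEntropy {A B : Type*} [Fintype A] [DecidableEq A] [Fintype B]
    (ψ : EuclideanSpace ℂ (A × B)) : ℝ :=
  vonNeumannEntropy (reduceA_ketBra_isHermitian ψ)

/-- The trace norm `‖X‖₁ = Tr √(Xᴴ X)`, i.e. the sum of the singular values of `X`. -/
def traceNorm {n : Type*} [Fintype n] [DecidableEq n] (X : Matrix n n ℂ) : ℝ :=
  ∑ i, √((Matrix.isHermitian_conjTranspose_mul_self X).eigenvalues i)

/-- The operator `ρ^{AB} ⊗ τ^{A'B'}`, with the tensor factors ordered as `(A A') (B B')`: Alice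
holds `A × A'` and Bob holds `B × B'`. -/
def withCatalyst {A B A' B' : Type*} (ρ : Matrix (A × B) (A × B) ℂ)
    (τ : Matrix (A' × B') (A' × B') ℂ) :
    Matrix ((A × A') × (B × B')) ((A × A') × (B × B')) ℂ :=
  Matrix.of fun x y =>
    ρ (x.1.1, x.2.1) (y.1.1, y.2.1) * τ (x.1.2, x.2.2) (y.1.2, y.2.2)

/-- The partial trace `Tr_{AB}`, leaving an operator on the catalyst `A'B'`. -/
def traceSystem {A B A' B' : Type*} [Fintype A] [Fintype B]
    (X : Matrix ((A × A') × (B × B')) ((A × A') × (B × B')) ℂ) :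
    Matrix (A' × B') (A' × B') ℂ :=
  Matrix.of fun x y => ∑ a, ∑ b, X ((a, x.1), (b, x.2)) ((a, y.1), (b, y.2))

/-- The map `X ↦ V X Vᴴ`. -/
def conjBy {m n : Type*} [Fintype n] (V : Matrix m n ℂ) :
    Matrix n n ℂ →ₗ[ℂ] Matrix m m ℂ where
  toFun X := V * X * Vᴴ
  map_add' X Y := by simp [Matrix.mul_add, Matrix.add_mul]
  map_smul' c X := by simp

/-- `IsLOCC Λ`: the map `Λ`, from operators on `A ⊗ B` to operators on `A' ⊗ B'`, is implemented by
a protocol with finitely many rounds of local operations and classical communication. In each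
round one party performs a local measurement with finitely many outcomes, given by Kraus operators
`K i` with `∑ i, (K i)ᴴ * K i = 1`, and announces the outcome `i`; the rest of the protocol, `Λ i`,
may depend on `i`. The Kraus operators may change the local dimension, so attaching and
discarding local systems is included (a discarded register is measured and the outcome is
ignored). All outcomes are summed over at the end. -/
inductive IsLOCC {A' B' : Type} : ∀ {A B : Type},
    (Matrix (A × B) (A × B) ℂ →ₗ[ℂ] Matrix (A' × B') (A' × B') ℂ) → Prop
  /-- The protocol without any rounds. -/
  | done : IsLOCC LinearMap.id
  /-- Alice measures, then the protocol continues according to her outcome. -/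
  | alice {A B A₁ ι : Type} [Fintype A] [DecidableEq A] [Fintype B] [DecidableEq B]
      [Fintype A₁] [Fintype ι] (K : ι → Matrix A₁ A ℂ) (hK : ∑ i, (K i)ᴴ * K i = 1)
      (Λ : ι → Matrix (A₁ × B) (A₁ × B) ℂ →ₗ[ℂ] Matrix (A' × B') (A' × B') ℂ)
      (hΛ : ∀ i, IsLOCC (Λ i)) :
      IsLOCC (∑ i, Λ i ∘ₗ conjBy (K i ⊗ₖ (1 : Matrix B B ℂ)))
  /-- Bob measures, then the protocol continues according to his outcome. -/
  | bob {A B B₁ ι : Type} [Fintype A] [DecidableEq A] [Fintype B] [DecidableEq B]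
      [Fintype B₁] [Fintype ι] (K : ι → Matrix B₁ B ℂ) (hK : ∑ i, (K i)ᴴ * K i = 1)
      (Λ : ι → Matrix (A × B₁) (A × B₁) ℂ →ₗ[ℂ] Matrix (A' × B') (A' × B') ℂ)
      (hΛ : ∀ i, IsLOCC (Λ i)) :
      IsLOCC (∑ i, Λ i ∘ₗ conjBy ((1 : Matrix A A ℂ) ⊗ₖ K i))

end UniversalCatalysis

end

open scoped Kronecker ComplexOrder

noncomputable section

namespace UniversalCatalysis

open Matrix

/-! ### Calculus of LOCC transformations -/

/-! A strict entropy gap makes many copies of `ψ` convertible into approximately as many copies of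
`φ`. By the asymptotic equipartition property, the typical Schmidt weights of `ψ` are so small, and
the typical sequences of `φ` so few, that the truncated weights of `ψ` are a mixture of permutations
of those of `φ`. Such a mixture is implemented exactly by one measurement of Alice and corrections
by Bob (`Convertible.of_mixture`, Nielsen's protocol). Truncation costs only a small error
(`exists_convertible_near`, `exists_convertible_tensorPow`).

Such a many-copy protocol becomes a catalyst for a single copy. Let `Γ` be its output. Repeatedly
dropping the last copy and inserting a fresh `ψ` in front leads from `Γ` back to a power of `ψ`,
which the protocol turns into `Γ` again. The catalyst is the uniform mixture, labelled by a register
of Alice, of the stages of this cycle with the last copy removed. One step of the cycle permutes the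
stages, so the catalyst returns exactly, while the dropped copy is close to `φ` and nearly
uncorrelated with the rest (`exists_catalyst_of_cycle`, `exists_catalyst_of_prodOp`).

A tensor product of catalysts serves finitely many pairs (`exists_common_catalyst`), so universality
needs finite nets. Targets may be approximated: each `φ` is near a net point whose entropy is lower
by a uniform `δ`, or which is reachable from every unit vector (`exists_target_net`). Sources are
replaced by exact LOCC, so that the catalyst still returns exactly: each `ψ` converts into a net
point at an entropy loss of at most `δ / 2` (`exists_source_net`). The pair of net points then has a
strict gap, even if `ψ` and `φ` have equal entropy. -/

theorem IsLOCC.comp {A B A₁ B₁ A₂ B₂ : Type}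
    {Λ₁ : Matrix (A × B) (A × B) ℂ →ₗ[ℂ] Matrix (A₁ × B₁) (A₁ × B₁) ℂ}
    {Λ₂ : Matrix (A₁ × B₁) (A₁ × B₁) ℂ →ₗ[ℂ] Matrix (A₂ × B₂) (A₂ × B₂) ℂ}
    (h₂ : IsLOCC Λ₂) (h₁ : IsLOCC Λ₁) : IsLOCC (Λ₂ ∘ₗ Λ₁) := by
  induction h₁ with
  | done => simpa using h₂
  | alice K hK Λ hΛ ih =>
    have := IsLOCC.alice K hK (fun i => Λ₂ ∘ₗ Λ i) (fun i => ih i)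
    convert this using 1
    ext1 X
    simp
  | bob K hK Λ hΛ ih =>
    have := IsLOCC.bob K hK (fun i => Λ₂ ∘ₗ Λ i) (fun i => ih i)
    convert this using 1
    ext1 X
    simp

/-- `ρ` can be transformed into `σ` by an LOCC protocol. -/
def Convertible {A B A₁ B₁ : Type} (ρ : Matrix (A × B) (A × B) ℂ)
    (σ : Matrix (A₁ × B₁) (A₁ × B₁) ℂ) : Prop :=
  ∃ Λ : Matrix (A × B) (A × B) ℂ →ₗ[ℂ] Matrix (A₁ × B₁) (A₁ × B₁) ℂ, IsLOCC Λ ∧ Λ ρ = σ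

theorem Convertible.refl {A B : Type} (ρ : Matrix (A × B) (A × B) ℂ) : Convertible ρ ρ :=
  ⟨_, IsLOCC.done, rfl⟩

theorem Convertible.trans {A B A₁ B₁ A₂ B₂ : Type} {ρ : Matrix (A × B) (A × B) ℂ}
    {σ : Matrix (A₁ × B₁) (A₁ × B₁) ℂ} {τ : Matrix (A₂ × B₂) (A₂ × B₂) ℂ}
    (h₁ : Convertible ρ σ) (h₂ : Convertible σ τ) : Convertible ρ τ := by
  obtain ⟨Λ₁, h₁, rfl⟩ := h₁
  obtain ⟨Λ₂, h₂, rfl⟩ := h₂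
  exact ⟨_, h₂.comp h₁, rfl⟩

theorem Convertible.smul {A B A₁ B₁ : Type} {ρ : Matrix (A × B) (A × B) ℂ}
    {σ : Matrix (A₁ × B₁) (A₁ × B₁) ℂ} (h : Convertible ρ σ) (c : ℂ) :
    Convertible (c • ρ) (c • σ) := by
  obtain ⟨Λ, hΛ, rfl⟩ := h
  exact ⟨Λ, hΛ, by simp⟩

/-- Branches of probability zero still need a continuation with the right output type; by linearity
any available protocol will do. -/
theorem Convertible.zero {A B A₁ B₁ : Type} {ρ : Matrix (A × B) (A × B) ℂ}
    {σ : Matrix (A₁ × B₁) (A₁ × B₁) ℂ} (h : Convertible ρ σ) :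
    Convertible (0 : Matrix (A × B) (A × B) ℂ) (0 : Matrix (A₁ × B₁) (A₁ × B₁) ℂ) := by
  simpa using h.smul 0

/-- The branch operators are unnormalized: their traces carry the outcome probabilities, so the
branches simply add up. -/
theorem Convertible.alice {A B A₁ A₂ B₂ ι : Type} [Fintype A] [DecidableEq A] [Fintype B]
    [DecidableEq B] [Fintype A₁] [Fintype ι] (K : ι → Matrix A₁ A ℂ)
    (hK : ∑ i, (K i)ᴴ * K i = 1) {ρ : Matrix (A × B) (A × B) ℂ}
    {σ : ι → Matrix (A₂ × B₂) (A₂ × B₂) ℂ}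
    (h : ∀ i, Convertible (conjBy (K i ⊗ₖ (1 : Matrix B B ℂ)) ρ) (σ i)) :
    Convertible ρ (∑ i, σ i) := by
  choose Λ hΛ hσ using h
  exact ⟨_, IsLOCC.alice K hK Λ hΛ, by simp [hσ]⟩

theorem Convertible.bob {A B B₁ A₂ B₂ ι : Type} [Fintype A] [DecidableEq A] [Fintype B]
    [DecidableEq B] [Fintype B₁] [Fintype ι] (K : ι → Matrix B₁ B ℂ)
    (hK : ∑ i, (K i)ᴴ * K i = 1) {ρ : Matrix (A × B) (A × B) ℂ}
    {σ : ι → Matrix (A₂ × B₂) (A₂ × B₂) ℂ}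
    (h : ∀ i, Convertible (conjBy ((1 : Matrix A A ℂ) ⊗ₖ K i) ρ) (σ i)) :
    Convertible ρ (∑ i, σ i) := by
  choose Λ hΛ hσ using h
  exact ⟨_, IsLOCC.bob K hK Λ hΛ, by simp [hσ]⟩

theorem conjBy_kronecker_one_apply {A B A₁ : Type*} [Fintype A] [Fintype B] [DecidableEq B]
    (K : Matrix A₁ A ℂ) (X : Matrix (A × B) (A × B) ℂ) (a c : A₁) (b d : B) :
    conjBy (K ⊗ₖ (1 : Matrix B B ℂ)) X (a, b) (c, d) =
      ∑ j, ∑ i, K a i * X (i, b) (j, d) * star (K c j) := by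
  simp only [conjBy, LinearMap.coe_mk, AddHom.coe_mk, Matrix.mul_apply, Fintype.sum_prod_type,
    kroneckerMap_apply, conjTranspose_apply, Matrix.one_apply]
  refine Finset.sum_congr rfl fun j _ => ?_
  rw [Finset.sum_eq_single d (fun x _ hx => by simp [hx.symm]) (by simp)]
  simp only [if_true, mul_one, Finset.sum_mul]
  refine Finset.sum_congr rfl fun i _ => ?_
  rw [Finset.sum_eq_single b (fun x _ hx => by simp [hx.symm]) (by simp)]
  simp

theorem conjBy_one_kronecker_apply {A B B₁ : Type*} [Fintype A] [Fintype B] [DecidableEq A]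
    (K : Matrix B₁ B ℂ) (X : Matrix (A × B) (A × B) ℂ) (a c : A) (b d : B₁) :
    conjBy ((1 : Matrix A A ℂ) ⊗ₖ K) X (a, b) (c, d) =
      ∑ j, ∑ i, K b i * X (a, i) (c, j) * star (K d j) := by
  simp only [conjBy, LinearMap.coe_mk, AddHom.coe_mk, Matrix.mul_apply, Fintype.sum_prod_type,
    kroneckerMap_apply, conjTranspose_apply, Matrix.one_apply]
  rw [Finset.sum_eq_single c (fun x _ hx => by simp [hx.symm]) (by simp)]
  refine Finset.sum_congr rfl fun j _ => ?_
  rw [Finset.sum_eq_single a (fun x _ hx => by simp [hx.symm]) (by simp)]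
  simp [Finset.sum_mul]

/-- Alice applies a local isometry. -/
theorem Convertible.alice_isometry {A B A₁ : Type} [Fintype A] [DecidableEq A] [Fintype B]
    [DecidableEq B] [Fintype A₁] (K : Matrix A₁ A ℂ) (hK : Kᴴ * K = 1)
    (ρ : Matrix (A × B) (A × B) ℂ) :
    Convertible ρ (conjBy (K ⊗ₖ (1 : Matrix B B ℂ)) ρ) := by
  have := Convertible.alice (ι := Unit) (fun _ => K) (by simpa using hK) (ρ := ρ)
    (σ := fun _ => conjBy (K ⊗ₖ (1 : Matrix B B ℂ)) ρ) (fun _ => .refl _)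
  simpa using this

theorem Convertible.bob_isometry {A B B₁ : Type} [Fintype A] [DecidableEq A] [Fintype B]
    [DecidableEq B] [Fintype B₁] (K : Matrix B₁ B ℂ) (hK : Kᴴ * K = 1)
    (ρ : Matrix (A × B) (A × B) ℂ) :
    Convertible ρ (conjBy ((1 : Matrix A A ℂ) ⊗ₖ K) ρ) := by
  have := Convertible.bob (ι := Unit) (fun _ => K) (by simpa using hK) (ρ := ρ)
    (σ := fun _ => conjBy ((1 : Matrix A A ℂ) ⊗ₖ K) ρ) (fun _ => .refl _)
  simpa using this

/-- The matrix of the coordinate permutation `e`. -/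
def relabelMatrix {A A₁ : Type*} [DecidableEq A] (e : A₁ ≃ A) : Matrix A₁ A ℂ :=
  (1 : Matrix A A ℂ).submatrix e id

theorem relabelMatrix_isometry {A A₁ : Type*} [Fintype A] [DecidableEq A] [Fintype A₁]
    (e : A₁ ≃ A) : (relabelMatrix e)ᴴ * relabelMatrix e = 1 := by
  rw [relabelMatrix, conjTranspose_submatrix, conjTranspose_one,
    submatrix_mul_equiv (1 : Matrix A A ℂ) 1 id e id]
  simp

theorem Convertible.relabel {A B A₁ B₁ : Type} [Fintype A] [DecidableEq A] [Fintype B]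
    [DecidableEq B] [Fintype A₁] [Fintype B₁] (e : A₁ ≃ A) (f : B₁ ≃ B)
    (ρ : Matrix (A × B) (A × B) ℂ) :
    Convertible ρ (ρ.submatrix (Prod.map e f) (Prod.map e f)) := by
  classical
  have h₁ := Convertible.alice_isometry (B := B) _ (relabelMatrix_isometry e) ρ
  have h₂ := Convertible.bob_isometry (A := A₁) _ (relabelMatrix_isometry f)
    (conjBy (relabelMatrix e ⊗ₖ (1 : Matrix B B ℂ)) ρ)
  convert h₁.trans h₂ using 1
  ext ⟨a, b⟩ ⟨c, d⟩
  simp [conjBy_kronecker_one_apply, conjBy_one_kronecker_apply, relabelMatrix, Matrix.one_apply]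

theorem sum_kronecker_one_isometry {A B A₁ ι : Type*} [Fintype A] [DecidableEq A] [Fintype B]
    [DecidableEq B] [Fintype A₁] [Fintype ι] {K : ι → Matrix A₁ A ℂ}
    (hK : ∑ i, (K i)ᴴ * K i = 1) :
    ∑ i, (K i ⊗ₖ (1 : Matrix B B ℂ))ᴴ * (K i ⊗ₖ (1 : Matrix B B ℂ)) = 1 := by
  simp only [conjTranspose_kronecker, ← mul_kronecker_mul, conjTranspose_one, mul_one]
  rw [← one_kronecker_one, ← hK]
  ext x y
  simp [Matrix.sum_apply, Finset.sum_mul]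

theorem sum_one_kronecker_isometry {A B B₁ ι : Type*} [Fintype A] [DecidableEq A] [Fintype B]
    [DecidableEq B] [Fintype B₁] [Fintype ι] {K : ι → Matrix B₁ B ℂ}
    (hK : ∑ i, (K i)ᴴ * K i = 1) :
    ∑ i, ((1 : Matrix A A ℂ) ⊗ₖ K i)ᴴ * ((1 : Matrix A A ℂ) ⊗ₖ K i) = 1 := by
  simp only [conjTranspose_kronecker, ← mul_kronecker_mul, conjTranspose_one, mul_one]
  rw [← one_kronecker_one, ← hK]
  ext x y
  simp [Matrix.sum_apply, Finset.mul_sum]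

/-! ### Protocols in the presence of an idle system. -/

theorem withCatalyst_sum_left {A B A' B' ι : Type*} (s : Finset ι)
    (X : ι → Matrix (A × B) (A × B) ℂ) (τ : Matrix (A' × B') (A' × B') ℂ) :
    withCatalyst (∑ i ∈ s, X i) τ = ∑ i ∈ s, withCatalyst (X i) τ := by
  ext; simp [withCatalyst, Finset.sum_mul, Matrix.sum_apply]

theorem IsLOCC.withCatalyst {A B A₁ B₁ A' B' : Type} [Fintype A'] [DecidableEq A'] [Fintype B']
    [DecidableEq B'] {Λ : Matrix (A × B) (A × B) ℂ →ₗ[ℂ] Matrix (A₁ × B₁) (A₁ × B₁) ℂ}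
    (h : IsLOCC Λ) (τ : Matrix (A' × B') (A' × B') ℂ) :
    ∃ Λ' : Matrix ((A × A') × (B × B')) ((A × A') × (B × B')) ℂ →ₗ[ℂ]
        Matrix ((A₁ × A') × (B₁ × B')) ((A₁ × A') × (B₁ × B')) ℂ,
      IsLOCC Λ' ∧ ∀ X, Λ' (withCatalyst X τ) = UniversalCatalysis.withCatalyst (Λ X) τ := by
  induction h with
  | done => exact ⟨_, .done, fun X => rfl⟩
  | @alice A B A₁ ι _ _ _ _ _ _ K hK Λ hΛ ih =>
    choose Λ' hΛ' h' using ih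
    refine ⟨_, IsLOCC.alice (fun i => K i ⊗ₖ (1 : Matrix A' A' ℂ)) ?_ Λ' hΛ', fun X => ?_⟩
    · exact sum_kronecker_one_isometry hK
    · simp only [LinearMap.sum_apply, LinearMap.comp_apply, withCatalyst_sum_left, ← h']
      refine Finset.sum_congr rfl fun i _ => congrArg _ ?_
      ext ⟨⟨a, a'⟩, ⟨b, b'⟩⟩ ⟨⟨c, c'⟩, ⟨d, d'⟩⟩
      rw [conjBy_kronecker_one_apply]
      simp only [UniversalCatalysis.withCatalyst, of_apply, conjBy_kronecker_one_apply]
      simp [Matrix.one_apply, Fintype.sum_prod_type, Finset.sum_mul, ← mul_assoc, mul_right_comm,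
        apply_ite]
  | @bob A B B₁ ι _ _ _ _ _ _ K hK Λ hΛ ih =>
    choose Λ' hΛ' h' using ih
    refine ⟨_, IsLOCC.bob (fun i => K i ⊗ₖ (1 : Matrix B' B' ℂ)) ?_ Λ' hΛ', fun X => ?_⟩
    · exact sum_kronecker_one_isometry hK
    · simp only [LinearMap.sum_apply, LinearMap.comp_apply, withCatalyst_sum_left, ← h']
      refine Finset.sum_congr rfl fun i _ => congrArg _ ?_
      ext ⟨⟨a, a'⟩, ⟨b, b'⟩⟩ ⟨⟨c, c'⟩, ⟨d, d'⟩⟩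
      rw [conjBy_one_kronecker_apply]
      simp only [UniversalCatalysis.withCatalyst, of_apply, conjBy_one_kronecker_apply]
      simp [Matrix.one_apply, Fintype.sum_prod_type, Finset.sum_mul, ← mul_assoc, mul_right_comm,
        apply_ite]

theorem Convertible.withCatalyst {A B A₁ B₁ A' B' : Type} [Fintype A'] [DecidableEq A']
    [Fintype B'] [DecidableEq B'] {ρ : Matrix (A × B) (A × B) ℂ}
    {σ : Matrix (A₁ × B₁) (A₁ × B₁) ℂ} (h : Convertible ρ σ)
    (τ : Matrix (A' × B') (A' × B') ℂ) :
    Convertible (UniversalCatalysis.withCatalyst ρ τ) (UniversalCatalysis.withCatalyst σ τ) := by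
  obtain ⟨Λ, hΛ, rfl⟩ := h
  obtain ⟨Λ', hΛ', h⟩ := hΛ.withCatalyst τ
  exact ⟨Λ', hΛ', h ρ⟩

/-! ### LOCC maps are positive and trace preserving. -/

theorem posSemidef_conjBy {m n : Type*} [Fintype m] [Fintype n] (V : Matrix m n ℂ)
    {X : Matrix n n ℂ} (hX : X.PosSemidef) : (conjBy V X).PosSemidef :=
  hX.mul_mul_conjTranspose_same V

theorem trace_conjBy {m n : Type*} [Fintype m] [Fintype n] (V : Matrix m n ℂ)
    (X : Matrix n n ℂ) : (conjBy V X).trace = (Vᴴ * V * X).trace := by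
  simp only [conjBy, LinearMap.coe_mk, AddHom.coe_mk]
  rw [Matrix.trace_mul_comm, ← Matrix.mul_assoc]

theorem trace_sum_conjBy {m n ι : Type*} [Fintype m] [Fintype n] [DecidableEq n] [Fintype ι]
    (V : ι → Matrix m n ℂ) (hV : ∑ i, (V i)ᴴ * V i = 1) (X : Matrix n n ℂ) :
    ∑ i, (conjBy (V i) X).trace = X.trace := by
  simp only [trace_conjBy]
  rw [← Matrix.trace_sum, ← Matrix.sum_mul, hV, Matrix.one_mul]

/-- The input dimensions vary along the induction, so their instances are quantified in the
conclusion and then identified with those stored in the constructors. -/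
theorem IsLOCC.posSemidef_and_trace {A B A₁ B₁ : Type} [j₁ : Fintype A₁] [j₂ : Fintype B₁]
    {Λ : Matrix (A × B) (A × B) ℂ →ₗ[ℂ] Matrix (A₁ × B₁) (A₁ × B₁) ℂ} (h : IsLOCC Λ) :
    ∀ [Fintype A] [Fintype B] {X : Matrix (A × B) (A × B) ℂ}, X.PosSemidef →
      (Λ X).PosSemidef ∧ (Λ X).trace = X.trace := by
  induction h with
  | done =>
    intro i₁ i₂ X hX
    refine ⟨hX, ?_⟩
    obtain rfl : i₁ = j₁ := Subsingleton.elim _ _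
    obtain rfl : i₂ = j₂ := Subsingleton.elim _ _
    rfl
  | @alice A B A₁ ι j₁ _ j₂ _ _ _ K hK Λ hΛ ih =>
    intro i₁ i₂ X hX
    obtain rfl : i₁ = j₁ := Subsingleton.elim _ _
    obtain rfl : i₂ = j₂ := Subsingleton.elim _ _
    have h := fun i => ih i (posSemidef_conjBy (K i ⊗ₖ (1 : Matrix B B ℂ)) hX)
    simp only [LinearMap.sum_apply, LinearMap.comp_apply, Matrix.trace_sum]
    refine ⟨posSemidef_sum _ fun i _ => (h i).1, ?_⟩
    rw [Finset.sum_congr rfl fun i _ => (h i).2, trace_sum_conjBy _ (sum_kronecker_one_isometry hK)]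
  | @bob A B B₁ ι j₁ _ j₂ _ _ _ K hK Λ hΛ ih =>
    intro i₁ i₂ X hX
    obtain rfl : i₁ = j₁ := Subsingleton.elim _ _
    obtain rfl : i₂ = j₂ := Subsingleton.elim _ _
    have h := fun i => ih i (posSemidef_conjBy ((1 : Matrix A A ℂ) ⊗ₖ K i) hX)
    simp only [LinearMap.sum_apply, LinearMap.comp_apply, Matrix.trace_sum]
    refine ⟨posSemidef_sum _ fun i _ => (h i).1, ?_⟩
    rw [Finset.sum_congr rfl fun i _ => (h i).2, trace_sum_conjBy _ (sum_one_kronecker_isometry hK)]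

theorem Convertible.isDensityMatrix {A B A₁ B₁ : Type} [Fintype A] [Fintype B] [Fintype A₁]
    [Fintype B₁] {ρ : Matrix (A × B) (A × B) ℂ} {σ : Matrix (A₁ × B₁) (A₁ × B₁) ℂ}
    (h : Convertible ρ σ) (hρ : IsDensityMatrix ρ) : IsDensityMatrix σ := by
  obtain ⟨Λ, hΛ, rfl⟩ := h
  have := hΛ.posSemidef_and_trace hρ.1
  exact ⟨this.1, this.2.trans hρ.2⟩

/-! ### Spectral decompositions -/

theorem exists_spectral_decomposition {n : Type*} [Fintype n] [DecidableEq n] {X : Matrix n n ℂ}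
    (hX : X.IsHermitian) :
    ∃ U : Matrix n n ℂ, Uᴴ * U = 1 ∧
      X = U * diagonal (fun i => (hX.eigenvalues i : ℂ)) * Uᴴ := by
  refine ⟨hX.eigenvectorUnitary, ?_, ?_⟩
  · exact Unitary.coe_star_mul_self hX.eigenvectorUnitary
  · conv_lhs => rw [hX.spectral_theorem, Unitary.conjStarAlgAut_apply]
    rfl

/-- The eigenvalues of `U diag(a) Uᴴ` are the `a i`. -/
theorem sum_eigenvalues_eq {n : Type*} [Fintype n] [DecidableEq n] {X : Matrix n n ℂ}
    (hX : X.IsHermitian) {U : Matrix n n ℂ} (hU : Uᴴ * U = 1) {a : n → ℝ}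
    (h : X = U * diagonal (fun i => (a i : ℂ)) * Uᴴ) (f : ℝ → ℝ) :
    ∑ i, f (hX.eigenvalues i) = ∑ i, f (a i) := by
  -- The order of the eigenvalues is lost, so both families are compared as the multiset of roots of
  -- the characteristic polynomial.
  have h₁ : X.charpoly.roots = Finset.univ.val.map fun i => (a i : ℂ) := by
    rw [h, charpoly_mul_comm, ← mul_assoc, hU, one_mul, charpoly_diagonal]
    simpa using Polynomial.roots_multiset_prod_X_sub_C
      (Finset.univ.val.map fun i => (a i : ℂ))
  have h₂ := hX.roots_charpoly_eq_eigenvalues.symm.trans h₁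
  have h₃ := congrArg (fun s => (s.map fun z : ℂ => f z.re).sum) h₂
  simpa [Multiset.map_map, Function.comp_def] using h₃

/-! ### Differences of states -/

/-- `X` is a difference of positive operators whose traces add up to at most `c`. This bounds the
trace norm of `X`. -/
def TraceBound {n : Type*} [Fintype n] (c : ℝ) (X : Matrix n n ℂ) : Prop :=
  ∃ P Q : Matrix n n ℂ, P.PosSemidef ∧ Q.PosSemidef ∧ X = P - Q ∧ P.trace.re + Q.trace.re ≤ c

section TraceBound

variable {n m : Type*} [Fintype n] [Fintype m]

/-- In an eigenbasis of `P - Q` each eigenvalue is a difference of nonnegative diagonal entries of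
`P` and `Q`, hence bounded in absolute value by their sum. All other estimates are made on
decompositions, which need no triangle inequality for the trace norm. -/
theorem TraceBound.traceNorm_le [DecidableEq n] {c : ℝ} {X : Matrix n n ℂ} (h : TraceBound c X) :
    traceNorm X ≤ c := by
  obtain ⟨P, Q, hP, hQ, rfl, hc⟩ := h
  have hX : (P - Q).IsHermitian := hP.1.sub hQ.1
  obtain ⟨U, hU, hUX⟩ := exists_spectral_decomposition hX
  have hU' : U * Uᴴ = 1 := mul_eq_one_comm.mp hU
  have hsq : (P - Q)ᴴ * (P - Q) =
      U * diagonal (fun i => ((hX.eigenvalues i ^ 2 : ℝ) : ℂ)) * Uᴴ := by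
    rw [hX.eq]
    conv_lhs => rw [hUX]
    rw [show U * diagonal (fun i => (hX.eigenvalues i : ℂ)) * Uᴴ *
        (U * diagonal (fun i => (hX.eigenvalues i : ℂ)) * Uᴴ) =
        U * (diagonal (fun i => (hX.eigenvalues i : ℂ)) * (Uᴴ * U) *
          diagonal (fun i => (hX.eigenvalues i : ℂ))) * Uᴴ by simp only [mul_assoc]]
    rw [hU, mul_one, diagonal_mul_diagonal]
    simp [sq]
  have hdiag : ∀ i, (hX.eigenvalues i : ℂ) = (Uᴴ * P * U) i i - (Uᴴ * Q * U) i i := by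
    intro i
    have : Uᴴ * (P - Q) * U = diagonal (fun i => (hX.eigenvalues i : ℂ)) := by
      conv_lhs => rw [hUX]
      rw [← mul_assoc, ← mul_assoc, hU, one_mul, mul_assoc, hU, mul_one]
    rw [Matrix.mul_sub, Matrix.sub_mul] at this
    rw [← Matrix.sub_apply, this, diagonal_apply_eq]
  have htr : ∀ R : Matrix n n ℂ, ∑ i, ((Uᴴ * R * U) i i).re = R.trace.re := by
    intro R
    rw [← Complex.re_sum]
    change (Matrix.trace (Uᴴ * R * U)).re = _
    rw [trace_mul_comm, ← mul_assoc, hU', one_mul]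
  unfold traceNorm
  rw [sum_eigenvalues_eq _ hU hsq Real.sqrt]
  calc ∑ i, √(hX.eigenvalues i ^ 2) ≤ ∑ i, (((Uᴴ * P * U) i i).re + ((Uᴴ * Q * U) i i).re) := by
        refine Finset.sum_le_sum fun i _ => ?_
        rw [Real.sqrt_sq_eq_abs]
        have h₁ := (Complex.nonneg_iff.mp ((hP.conjTranspose_mul_mul_same U).diag_nonneg (i := i))).1
        have h₂ := (Complex.nonneg_iff.mp ((hQ.conjTranspose_mul_mul_same U).diag_nonneg (i := i))).1
        have h₃ := congrArg Complex.re (hdiag i)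
        simp only [Complex.ofReal_re, Complex.sub_re] at h₃
        rw [abs_le]
        constructor <;> linarith
    _ = P.trace.re + Q.trace.re := by rw [Finset.sum_add_distrib, htr, htr]
    _ ≤ c := hc

theorem TraceBound.mono {c d : ℝ} {X : Matrix n n ℂ} (h : TraceBound c X) (hcd : c ≤ d) :
    TraceBound d X := by
  obtain ⟨P, Q, hP, hQ, hX, hc⟩ := h
  exact ⟨P, Q, hP, hQ, hX, hc.trans hcd⟩

theorem TraceBound.zero : TraceBound 0 (0 : Matrix n n ℂ) :=
  ⟨0, 0, .zero, .zero, by simp, by simp⟩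

theorem TraceBound.of_posSemidef {X : Matrix n n ℂ} (h : X.PosSemidef) :
    TraceBound X.trace.re X :=
  ⟨X, 0, h, .zero, by simp, by simp⟩

theorem TraceBound.add {c d : ℝ} {X Y : Matrix n n ℂ} (h : TraceBound c X)
    (h' : TraceBound d Y) : TraceBound (c + d) (X + Y) := by
  obtain ⟨P, Q, hP, hQ, rfl, hc⟩ := h
  obtain ⟨P', Q', hP', hQ', rfl, hd⟩ := h'
  refine ⟨P + P', Q + Q', hP.add hP', hQ.add hQ', by abel, ?_⟩
  simp only [trace_add, Complex.add_re]
  linarith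

theorem TraceBound.neg {c : ℝ} {X : Matrix n n ℂ} (h : TraceBound c X) : TraceBound c (-X) := by
  obtain ⟨P, Q, hP, hQ, rfl, hc⟩ := h
  exact ⟨Q, P, hQ, hP, by abel, by linarith⟩

theorem TraceBound.sub_comm {c : ℝ} {X Y : Matrix n n ℂ} (h : TraceBound c (X - Y)) :
    TraceBound c (Y - X) := by
  simpa using h.neg

theorem TraceBound.trans {c d : ℝ} {X Y Z : Matrix n n ℂ} (h : TraceBound c (X - Y))
    (h' : TraceBound d (Y - Z)) : TraceBound (c + d) (X - Z) := by
  simpa using h.add h'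

theorem TraceBound.sum {ι : Type*} {s : Finset ι} {c : ι → ℝ} {X : ι → Matrix n n ℂ}
    (h : ∀ i ∈ s, TraceBound (c i) (X i)) : TraceBound (∑ i ∈ s, c i) (∑ i ∈ s, X i) := by
  classical
  induction s using Finset.induction_on with
  | empty => simpa using TraceBound.zero
  | insert i s hi ih =>
    rw [Finset.sum_insert hi, Finset.sum_insert hi]
    exact (h i (by simp)).add (ih fun j hj => h j (by simp [hj]))

theorem posSemidef_real_smul {n : Type*} {X : Matrix n n ℂ} (h : X.PosSemidef) {r : ℝ} (hr : 0 ≤ r) :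
    ((r : ℂ) • X).PosSemidef :=
  h.smul (by exact_mod_cast hr)

theorem TraceBound.smul {c : ℝ} {X : Matrix n n ℂ} (h : TraceBound c X) {r : ℝ} (hr : 0 ≤ r) :
    TraceBound (r * c) ((r : ℂ) • X) := by
  obtain ⟨P, Q, hP, hQ, rfl, hc⟩ := h
  refine ⟨(r : ℂ) • P, (r : ℂ) • Q, posSemidef_real_smul hP hr, posSemidef_real_smul hQ hr,
    smul_sub _ _ _, ?_⟩
  simp only [trace_smul, smul_eq_mul, Complex.re_ofReal_mul]
  nlinarith

/-- Positive trace-preserving maps do not increase the bound. -/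
theorem TraceBound.map {c : ℝ} {X : Matrix n n ℂ} (h : TraceBound c X)
    (f : Matrix n n ℂ →ₗ[ℂ] Matrix m m ℂ)
    (hf : ∀ P : Matrix n n ℂ, P.PosSemidef → (f P).PosSemidef ∧ (f P).trace = P.trace) :
    TraceBound c (f X) := by
  obtain ⟨P, Q, hP, hQ, rfl, hc⟩ := h
  refine ⟨f P, f Q, (hf P hP).1, (hf Q hQ).1, map_sub f P Q, ?_⟩
  rwa [(hf P hP).2, (hf Q hQ).2]

theorem trace_submatrix (X : Matrix n n ℂ) (e : m ≃ n) : (X.submatrix e e).trace = X.trace :=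
  e.sum_comp fun i => X i i

theorem TraceBound.submatrix {c : ℝ} {X : Matrix n n ℂ} (h : TraceBound c X) (e : m ≃ n) :
    TraceBound c (X.submatrix e e) := by
  obtain ⟨P, Q, hP, hQ, rfl, hc⟩ := h
  refine ⟨P.submatrix e e, Q.submatrix e e, hP.submatrix e, hQ.submatrix e, rfl, ?_⟩
  rwa [trace_submatrix, trace_submatrix]

end TraceBound

/-! ### Tensor products and partial traces -/

section Tensor

theorem withCatalyst_sub_left {A B A' B' : Type*} (X X' : Matrix (A × B) (A × B) ℂ)
    (Y : Matrix (A' × B') (A' × B') ℂ) :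
    withCatalyst (X - X') Y = withCatalyst X Y - withCatalyst X' Y := by
  ext; simp [withCatalyst, sub_mul]

theorem withCatalyst_sub_right {A B A' B' : Type*} (X : Matrix (A × B) (A × B) ℂ)
    (Y Y' : Matrix (A' × B') (A' × B') ℂ) :
    withCatalyst X (Y - Y') = withCatalyst X Y - withCatalyst X Y' := by
  ext; simp [withCatalyst, mul_sub]

theorem traceSystem_withCatalyst {A B A' B' : Type*} [Fintype A] [Fintype B]
    (X : Matrix (A × B) (A × B) ℂ) (Y : Matrix (A' × B') (A' × B') ℂ) :
    traceSystem (withCatalyst X Y) = X.trace • Y := by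
  ext x y
  simp [traceSystem, withCatalyst, Matrix.trace, Fintype.sum_prod_type, Finset.sum_mul]

theorem posSemidef_traceSystem {A B A' B' : Type*} [Fintype A] [Fintype B]
    {X : Matrix ((A × A') × (B × B')) ((A × A') × (B × B')) ℂ}
    (hX : X.PosSemidef) : (traceSystem X).PosSemidef := by
  have : traceSystem X = ∑ a, ∑ b, X.submatrix (fun x : A' × B' => ((a, x.1), (b, x.2)))
      (fun x : A' × B' => ((a, x.1), (b, x.2))) := by
    ext x y
    simp [traceSystem, Matrix.sum_apply]
  rw [this]
  exact posSemidef_sum _ fun a _ => posSemidef_sum _ fun b _ => hX.submatrix _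

variable {A B A' B' : Type*} [Fintype A] [Fintype B] [Fintype A'] [Fintype B']

theorem posSemidef_withCatalyst {X : Matrix (A × B) (A × B) ℂ} {Y : Matrix (A' × B') (A' × B') ℂ}
    (hX : X.PosSemidef) (hY : Y.PosSemidef) : (withCatalyst X Y).PosSemidef := by
  exact (hX.kronecker hY).submatrix
    (fun x : (A × A') × (B × B') => ((x.1.1, x.2.1), (x.1.2, x.2.2)))

theorem trace_traceSystem (X : Matrix ((A × A') × (B × B')) ((A × A') × (B × B')) ℂ) :
    (traceSystem X).trace = X.trace := by
  simp only [traceSystem, Matrix.trace, Fintype.sum_prod_type, diag_apply, of_apply]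
  simp only [Finset.sum_comm (s := (Finset.univ : Finset A'))]
  simp only [Finset.sum_comm (s := (Finset.univ : Finset B'))]

theorem trace_withCatalyst (X : Matrix (A × B) (A × B) ℂ) (Y : Matrix (A' × B') (A' × B') ℂ) :
    (withCatalyst X Y).trace = X.trace * Y.trace := by
  rw [← trace_traceSystem, traceSystem_withCatalyst, trace_smul, smul_eq_mul]

theorem IsDensityMatrix.withCatalyst {X : Matrix (A × B) (A × B) ℂ}
    {Y : Matrix (A' × B') (A' × B') ℂ} (hX : IsDensityMatrix X) (hY : IsDensityMatrix Y) :
    IsDensityMatrix (withCatalyst X Y) :=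
  ⟨posSemidef_withCatalyst hX.1 hY.1, by rw [trace_withCatalyst, hX.2, hY.2, mul_one]⟩

theorem IsDensityMatrix.traceSystem {X : Matrix ((A × A') × (B × B')) ((A × A') × (B × B')) ℂ}
    (hX : IsDensityMatrix X) : IsDensityMatrix (traceSystem X) :=
  ⟨posSemidef_traceSystem hX.1, by rw [trace_traceSystem, hX.2]⟩

theorem TraceBound.withCatalyst_left {c : ℝ} {X : Matrix (A × B) (A × B) ℂ} (h : TraceBound c X)
    {Y : Matrix (A' × B') (A' × B') ℂ} (hY : IsDensityMatrix Y) :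
    TraceBound c (withCatalyst X Y) := by
  obtain ⟨P, Q, hP, hQ, rfl, hc⟩ := h
  refine ⟨withCatalyst P Y, withCatalyst Q Y, posSemidef_withCatalyst hP hY.1,
    posSemidef_withCatalyst hQ hY.1, withCatalyst_sub_left _ _ _, ?_⟩
  simpa [trace_withCatalyst, hY.2] using hc

theorem TraceBound.withCatalyst_right {c : ℝ} {X : Matrix (A × B) (A × B) ℂ}
    {Y : Matrix (A' × B') (A' × B') ℂ} (h : TraceBound c Y) (hX : IsDensityMatrix X) :
    TraceBound c (withCatalyst X Y) := by
  obtain ⟨P, Q, hP, hQ, rfl, hc⟩ := h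
  refine ⟨withCatalyst X P, withCatalyst X Q, posSemidef_withCatalyst hX.1 hP,
    posSemidef_withCatalyst hX.1 hQ, withCatalyst_sub_right _ _ _, ?_⟩
  simpa [trace_withCatalyst, hX.2] using hc

theorem TraceBound.traceSystem {c : ℝ}
    {X : Matrix ((A × A') × (B × B')) ((A × A') × (B × B')) ℂ} (h : TraceBound c X) :
    TraceBound c (traceSystem X) := by
  obtain ⟨P, Q, hP, hQ, rfl, hc⟩ := h
  refine ⟨_, _, posSemidef_traceSystem hP, posSemidef_traceSystem hQ, ?_, ?_⟩
  · ext; simp [UniversalCatalysis.traceSystem]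
  · simpa [trace_traceSystem] using hc

end Tensor

/-! ### Pure states -/

/-- The operator `|M⟩⟩⟨⟨M|` of the (not necessarily normalized) vector with amplitudes `M`. -/
def pureOp {A B : Type*} (M : Matrix A B ℂ) : Matrix (A × B) (A × B) ℂ :=
  Matrix.of fun x y => M x.1 x.2 * star (M y.1 y.2)

section PureOp

variable {A B A₁ B₁ : Type*}

theorem posSemidef_pureOp [Fintype A] [Fintype B] (M : Matrix A B ℂ) : (pureOp M).PosSemidef :=
  posSemidef_vecMulVec_self_star fun x : A × B => M x.1 x.2

theorem trace_pureOp [Fintype A] [Fintype B] (M : Matrix A B ℂ) :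
    (pureOp M).trace = (M * Mᴴ).trace := by
  simp [pureOp, Matrix.trace, Matrix.mul_apply, Fintype.sum_prod_type]

theorem conjBy_pureOp_left [Fintype A] [Fintype B] [DecidableEq B] (K : Matrix A₁ A ℂ)
    (M : Matrix A B ℂ) : conjBy (K ⊗ₖ (1 : Matrix B B ℂ)) (pureOp M) = pureOp (K * M) := by
  ext ⟨a, b⟩ ⟨c, d⟩
  simp only [conjBy_kronecker_one_apply, pureOp, of_apply, Matrix.mul_apply, star_sum, star_mul',
    Finset.sum_mul_sum]
  rw [Finset.sum_comm]
  exact Finset.sum_congr rfl fun i _ => Finset.sum_congr rfl fun j _ => by ring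

theorem conjBy_pureOp_right [Fintype A] [Fintype B] [DecidableEq A] (K : Matrix B₁ B ℂ)
    (M : Matrix A B ℂ) : conjBy ((1 : Matrix A A ℂ) ⊗ₖ K) (pureOp M) = pureOp (M * Kᵀ) := by
  ext ⟨a, b⟩ ⟨c, d⟩
  simp only [conjBy_one_kronecker_apply, pureOp, of_apply, Matrix.mul_apply, star_sum, star_mul',
    Finset.sum_mul_sum, transpose_apply]
  rw [Finset.sum_comm]
  exact Finset.sum_congr rfl fun i _ => Finset.sum_congr rfl fun j _ => by ring

theorem pureOp_real_smul (r : ℝ) (M : Matrix A B ℂ) :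
    pureOp ((r : ℂ) • M) = ((r ^ 2 : ℝ) : ℂ) • pureOp M := by
  ext
  simp [pureOp]
  ring

@[simp] theorem pureOp_zero : pureOp (0 : Matrix A B ℂ) = 0 := by
  ext; simp [pureOp]

/-- With `D = X - Y` and `S = X + Y`, the difference is half of `|D⟩⟨S| + |S⟩⟨D|`, which polarizes
into the positive operators of `αD + α⁻¹S` and `αD - α⁻¹S`. The choice `α² = s / d` balances the two
contributions to the trace. -/
theorem TraceBound.pureOp_sub [Fintype A] [Fintype B] {X Y : Matrix A B ℂ} {d s : ℝ} (hd : 0 < d)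
    (hs : 0 < s) (hXY : (pureOp (X - Y)).trace.re ≤ d ^ 2)
    (hXY' : (pureOp (X + Y)).trace.re ≤ s ^ 2) : TraceBound (d * s) (pureOp X - pureOp Y) := by
  have key : pureOp X - pureOp Y =
      ((1 / 4 : ℝ) : ℂ) • pureOp (((√(s / d) : ℝ) : ℂ) • (X - Y) + (((√(s / d))⁻¹ : ℝ) : ℂ) • (X + Y))
      - ((1 / 4 : ℝ) : ℂ) • pureOp (((√(s / d) : ℝ) : ℂ) • (X - Y) -
        (((√(s / d))⁻¹ : ℝ) : ℂ) • (X + Y)) := by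
    have hα : ((√(s / d) : ℝ) : ℂ) ≠ 0 := by
      exact_mod_cast (Real.sqrt_pos.mpr (div_pos hs hd)).ne'
    ext
    simp [pureOp]
    field_simp
    ring
  refine ⟨_, _, posSemidef_real_smul (posSemidef_pureOp _) (by norm_num),
    posSemidef_real_smul (posSemidef_pureOp _) (by norm_num), key, ?_⟩
  have hpar : ∀ a b : Matrix A B ℂ, (pureOp (a + b)).trace.re + (pureOp (a - b)).trace.re =
      2 * (pureOp a).trace.re + 2 * (pureOp b).trace.re := by
    intro a b
    have : pureOp (a + b) + pureOp (a - b) = (2 : ℂ) • pureOp a + (2 : ℂ) • pureOp b := by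
      ext
      simp [pureOp]
      ring
    simpa using congrArg (fun Z => Z.trace.re) this
  simp only [trace_smul, smul_eq_mul, Complex.re_ofReal_mul]
  rw [← mul_add, hpar, pureOp_real_smul, pureOp_real_smul]
  simp only [trace_smul, smul_eq_mul, Complex.re_ofReal_mul]
  rw [inv_pow, Real.sq_sqrt (by positivity)]
  have h₁ : s / d * (pureOp (X - Y)).trace.re ≤ s / d * d ^ 2 := by gcongr
  have h₂ : (s / d)⁻¹ * (pureOp (X + Y)).trace.re ≤ (s / d)⁻¹ * s ^ 2 := by gcongr
  have h₃ : s / d * d ^ 2 = d * s := by field_simp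
  have h₄ : (s / d)⁻¹ * s ^ 2 = d * s := by field_simp
  linarith

end PureOp

/-! ### Deterministic transformations of pure states -/

/-- Kraus operators whose squares add up to a projection `Π` can be completed by Kraus operators
that annihilate the range of `Π`. -/
theorem exists_kraus_completion {A A₁ κ : Type*} [Fintype A] [DecidableEq A] [Fintype A₁]
    [Nonempty A₁] [Fintype κ] (K : κ → Matrix A₁ A ℂ) {R : Matrix A A ℂ}
    (hK : ∑ k, (K k)ᴴ * K k = R) (hR : R * R = R) :
    ∃ L : A → Matrix A₁ A ℂ, ∑ k, (K k)ᴴ * K k + ∑ a, (L a)ᴴ * L a = 1 ∧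
      ∀ {B : Type} (M : Matrix A B ℂ), R * M = M → ∀ a, L a * M = 0 := by
  classical
  have hRH : Rᴴ = R := by
    rw [← hK]
    simp [conjTranspose_sum]
  let j₀ : A₁ := Classical.arbitrary A₁
  -- The operator `1 - R` need not fit into the output space `A₁`, so its rows become separate
  -- outcomes, all mapping into the single direction `j₀`.
  refine ⟨fun a => Matrix.of fun j i => if j = j₀ then (1 - R) a i else 0, ?_, ?_⟩
  · have h₁ : ∑ a, (Matrix.of fun (j : A₁) i => if j = j₀ then (1 - R) a i else 0)ᴴ *
        (Matrix.of fun (j : A₁) i => if j = j₀ then (1 - R) a i else 0) = (1 - R)ᴴ * (1 - R) := by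
      ext i i'
      rw [Matrix.sum_apply]
      simp only [Matrix.mul_apply, conjTranspose_apply, of_apply]
      refine Finset.sum_congr rfl fun a _ => ?_
      rw [Finset.sum_eq_single j₀ (fun j _ hj => by simp [hj]) (by simp)]
      simp
    rw [h₁, hK, conjTranspose_sub, conjTranspose_one, hRH, Matrix.mul_sub, Matrix.sub_mul,
      Matrix.sub_mul, hR]
    simp
  · intro B M hM a
    ext j b
    have : ((1 - R) * M : Matrix A B ℂ) a b = 0 := by rw [Matrix.sub_mul, hM, Matrix.one_mul, sub_self, Matrix.zero_apply]
    rw [Matrix.mul_apply] at this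
    by_cases hj : j = j₀
    · simpa [Matrix.mul_apply, hj] using this
    · simp [Matrix.mul_apply, hj]

theorem Convertible.alice_pureOp {A B A₁ A₂ B₂ κ : Type} [Fintype A] [DecidableEq A] [Fintype B]
    [DecidableEq B] [Fintype A₁] [Nonempty A₁] [Fintype κ] [Nonempty κ] (K : κ → Matrix A₁ A ℂ)
    {R : Matrix A A ℂ} (hK : ∑ k, (K k)ᴴ * K k = R) (hR : R * R = R) {M : Matrix A B ℂ}
    (hM : R * M = M) {σ : κ → Matrix (A₂ × B₂) (A₂ × B₂) ℂ}
    (h : ∀ k, Convertible (pureOp (K k * M)) (σ k)) : Convertible (pureOp M) (∑ k, σ k) := by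
  obtain ⟨L, hL, hLM⟩ := exists_kraus_completion K hK hR
  have := Convertible.alice (ρ := pureOp M) (ι := κ ⊕ A) (Sum.elim K L)
    (by simpa using hL) (σ := Sum.elim σ fun _ => 0) (by
      rintro (k | a)
      · simpa [conjBy_pureOp_left] using h k
      · simpa [conjBy_pureOp_left, hLM M hM a] using (h (Classical.arbitrary κ)).zero)
  simpa using this

theorem Convertible.bob_pureOp {A B B₁ : Type} [Fintype A] [DecidableEq A] [Fintype B]
    [DecidableEq B] [Fintype B₁] [Nonempty B₁] (K : Matrix B₁ B ℂ)
    (hK : (Kᴴ * K) * (Kᴴ * K) = Kᴴ * K) {M : Matrix A B ℂ} (hM : Kᴴ * K * Mᵀ = Mᵀ) :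
    Convertible (pureOp M) (pureOp (M * Kᵀ)) := by
  obtain ⟨L, hL, hLM⟩ := exists_kraus_completion (κ := Unit) (fun _ => K) (by simp) hK
  have := Convertible.bob (ρ := pureOp M) (ι := Unit ⊕ B) (Sum.elim (fun _ => K) L)
    (by simpa using hL) (σ := Sum.elim (fun _ => pureOp (M * Kᵀ)) fun _ => 0) (by
      rintro (k | b)
      · simpa [conjBy_pureOp_right] using Convertible.refl _
      · have h : M * (L b)ᵀ = 0 := by
          rw [← transpose_transpose M, ← transpose_mul, hLM _ hM, transpose_zero]
        simpa [conjBy_pureOp_right, h] using (Convertible.refl (pureOp (M * Kᵀ))).zero)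
  simpa using this

/-- `M` and `M * Mᴴ` have the same column space. -/
theorem eq_of_mul_conjTranspose_eq {A B : Type*} [Fintype A] [DecidableEq A] [Fintype B]
    {R : Matrix A A ℂ} {M : Matrix A B ℂ} (h : R * (M * Mᴴ) = M * Mᴴ) : R * M = M := by
  have : ((1 - R) * M) * ((1 - R) * M)ᴴ = 0 := by
    rw [conjTranspose_mul, Matrix.mul_assoc, ← Matrix.mul_assoc M, ← Matrix.mul_assoc, Matrix.sub_mul, h,
      Matrix.one_mul, sub_self, Matrix.zero_mul]
  rw [self_mul_conjTranspose_eq_zero, Matrix.sub_mul, Matrix.one_mul, sub_eq_zero] at this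
  exact this.symm

theorem exists_hermitian_pseudoinverse {A : Type*} [Fintype A] [DecidableEq A] {X : Matrix A A ℂ}
    (hX : X.IsHermitian) : ∃ Y : Matrix A A ℂ, Yᴴ = Y ∧ X * Y * X = X ∧ Y * X * Y = Y := by
  obtain ⟨U, hU, h⟩ := exists_spectral_decomposition hX
  set a := hX.eigenvalues
  have hmul : ∀ d e : A → ℂ, U * diagonal d * Uᴴ * (U * diagonal e * Uᴴ) =
      U * diagonal (fun i => d i * e i) * Uᴴ := by
    intro d e
    rw [← diagonal_mul_diagonal, show U * diagonal d * Uᴴ * (U * diagonal e * Uᴴ) =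
      U * (diagonal d * (Uᴴ * U) * diagonal e) * Uᴴ by simp only [Matrix.mul_assoc], hU, Matrix.mul_one]
  -- The convention `0⁻¹ = 0` makes this the inverse on the support and zero on the kernel.
  refine ⟨U * diagonal (fun i => ((a i)⁻¹ : ℂ)) * Uᴴ, ?_, ?_, ?_⟩
  · simp only [conjTranspose_mul, diagonal_conjTranspose, conjTranspose_conjTranspose, Matrix.mul_assoc]
    congr
    ext i
    simp
  · rw [h, hmul, hmul]
    congr
    ext i
    exact mul_inv_mul_cancel (a i : ℂ)
  · rw [h, hmul, hmul]
    congr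
    ext i
    by_cases hi : (a i : ℂ) = 0 <;> simp [hi]

/-- Purifications of the same marginal are related by an operation on Bob's side. -/
theorem Convertible.of_marginal_eq {A B B₁ : Type} [Fintype A] [DecidableEq A] [Fintype B]
    [DecidableEq B] [Fintype B₁] [Nonempty B₁] {M : Matrix A B ℂ} {N : Matrix A B₁ ℂ}
    (h : M * Mᴴ = N * Nᴴ) : Convertible (pureOp M) (pureOp N) := by
  obtain ⟨Y, hY, hXYX, hYXY⟩ := exists_hermitian_pseudoinverse (isHermitian_mul_conjTranspose_self M)
  have hM : M * Mᴴ * Y * M = M := eq_of_mul_conjTranspose_eq hXYX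
  have hN : M * Mᴴ * Y * N = N := by
    refine eq_of_mul_conjTranspose_eq ?_
    rw [← h, hXYX]
  set V := Mᴴ * Y * N with hV
  have hVV : V * Vᴴ = Mᴴ * Y * M := by
    rw [hV, conjTranspose_mul, conjTranspose_mul, conjTranspose_conjTranspose, hY]
    calc Mᴴ * Y * N * (Nᴴ * (Y * M)) = Mᴴ * (Y * (N * Nᴴ) * Y) * M := by simp only [Matrix.mul_assoc]
      _ = _ := by rw [← h, hYXY]
  have hKK : (Vᵀ)ᴴ * Vᵀ = (Mᴴ * Y * M)ᵀ := by
    rw [← hVV, Matrix.transpose_mul V Vᴴ]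
    rfl
  have hMV : M * (Vᵀ)ᵀ = N := by
    rw [transpose_transpose, hV, ← Matrix.mul_assoc, ← Matrix.mul_assoc, hN]
  have := Convertible.bob_pureOp (M := M) Vᵀ ?_ ?_
  · rwa [hMV] at this
  · rw [hKK, ← transpose_mul]
    congr 1
    calc Mᴴ * Y * M * (Mᴴ * Y * M) = Mᴴ * (Y * (M * Mᴴ) * Y) * M := by simp only [Matrix.mul_assoc]
      _ = _ := by rw [hYXY]
  · rw [hKK, ← transpose_mul]
    congr 1
    rw [← Matrix.mul_assoc, ← Matrix.mul_assoc, hM]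

/-- `M` has the Schmidt weights `a`, in the Schmidt basis given by the columns of `U`. -/
def HasSchmidtWeights {A B : Type*} [Fintype A] [DecidableEq A] [Fintype B] (M : Matrix A B ℂ)
    (U : Matrix A A ℂ) (a : A → ℝ) : Prop :=
  Uᴴ * U = 1 ∧ M * Mᴴ = U * diagonal (fun i => (a i : ℂ)) * Uᴴ

section Schmidt

variable {A B : Type*} [Fintype A] [DecidableEq A] [Fintype B] {M : Matrix A B ℂ}
  {U : Matrix A A ℂ} {a : A → ℝ}

theorem HasSchmidtWeights.nonneg (h : HasSchmidtWeights M U a) (i : A) : 0 ≤ a i := by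
  have h₁ : diagonal (fun i => (a i : ℂ)) = Uᴴ * (M * Mᴴ) * U := by
    rw [h.2, ← Matrix.mul_assoc, ← Matrix.mul_assoc, h.1, Matrix.one_mul, Matrix.mul_assoc, h.1, Matrix.mul_one]
  have h₂ := ((posSemidef_self_mul_conjTranspose M).conjTranspose_mul_mul_same U).diag_nonneg
    (i := i)
  rw [← h₁, diagonal_apply_eq] at h₂
  exact_mod_cast h₂

theorem HasSchmidtWeights.trace (h : HasSchmidtWeights M U a) :
    (pureOp M).trace = ((∑ i, a i : ℝ) : ℂ) := by
  rw [trace_pureOp, h.2, trace_mul_comm, ← Matrix.mul_assoc, h.1, Matrix.one_mul, trace_diagonal]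
  simp

/-- Rescaling the Schmidt weights by a filter in the Schmidt basis. -/
theorem HasSchmidtWeights.filter (h : HasSchmidtWeights M U a) (c : A → ℝ) :
    HasSchmidtWeights (U * diagonal (fun i => (c i : ℂ)) * Uᴴ * M) U (fun i => c i ^ 2 * a i) := by
  refine ⟨h.1, ?_⟩
  rw [conjTranspose_mul]
  calc _ = U * diagonal (fun i => (c i : ℂ)) * Uᴴ * (M * Mᴴ) *
        (U * diagonal (fun i => (c i : ℂ)) * Uᴴ)ᴴ := by simp only [Matrix.mul_assoc]
    _ = U * (diagonal (fun i => (c i : ℂ)) * (Uᴴ * U) * diagonal (fun i => (a i : ℂ)) * (Uᴴ * U) *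
        diagonal (fun i => star (c i : ℂ))) * Uᴴ := by
      rw [h.2]
      simp only [conjTranspose_mul, diagonal_conjTranspose, conjTranspose_conjTranspose, Matrix.mul_assoc]
      rfl
    _ = _ := by
      rw [h.1, Matrix.mul_one, Matrix.mul_one, diagonal_mul_diagonal, diagonal_mul_diagonal]
      congr
      ext i
      simp
      ring

end Schmidt

theorem exists_hasSchmidtWeights {A B : Type*} [Fintype A] [DecidableEq A] [Fintype B]
    (M : Matrix A B ℂ) : ∃ U, HasSchmidtWeights M U
      (isHermitian_mul_conjTranspose_self M).eigenvalues :=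
  exists_spectral_decomposition (isHermitian_mul_conjTranspose_self M)

/-- If the Schmidt weights of `M` are a mixture of permutations of those of `N`, then `M` can be
transformed into `N`. -/
theorem Convertible.of_mixture {A B B₁ κ : Type} [Fintype A] [DecidableEq A] [Fintype B]
    [DecidableEq B] [Fintype B₁] [Nonempty B₁] [Nonempty A] [Fintype κ] [Nonempty κ]
    {M : Matrix A B ℂ} {N : Matrix A B₁ ℂ} {U V : Matrix A A ℂ} {a b : A → ℝ}
    (hM : HasSchmidtWeights M U a) (hN : HasSchmidtWeights N V b) (p : κ → ℝ) (hp : ∀ k, 0 ≤ p k)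
    (π : κ → Equiv.Perm A) (hab : ∀ i, a i = ∑ k, p k * b (π k i)) :
    Convertible (pureOp M) (((∑ k, p k : ℝ) : ℂ) • pureOp N) := by
  have ha := hM.nonneg
  have hb := hN.nonneg
  -- Outcome `k` divides by the old amplitudes, permutes by `π k` and multiplies by the new ones,
  -- with a factor `√(p k)`. By the mixture identity the squares add up to the support projection of
  -- `a`. The value `(√0)⁻¹ = 0` is harmless: where `a i = 0`, all `p k * b (π k i)` vanish as well.
  let X : κ → Matrix A A ℂ := fun k => Matrix.of fun j i =>
    if j = π k i then ((√(p k) * √(b j) * (√(a i))⁻¹ : ℝ) : ℂ) else 0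
  have hpb : ∀ i, a i = 0 → ∀ k, p k * b (π k i) = 0 := by
    intro i hi k
    have := hab i
    rw [hi, eq_comm, Finset.sum_eq_zero_iff_of_nonneg fun k _ => mul_nonneg (hp k) (hb _)] at this
    exact this k (Finset.mem_univ _)
  have hXX : ∑ k, (X k)ᴴ * X k = diagonal fun i => if a i = 0 then 0 else 1 := by
    ext i i'
    rw [Matrix.sum_apply]
    have h₁ : ∀ k, ((X k)ᴴ * X k) i i' =
        if i = i' then ((p k * b (π k i) * (a i)⁻¹ : ℝ) : ℂ) else 0 := by
      intro k
      rw [Matrix.mul_apply, Finset.sum_eq_single (π k i) (fun j _ hj => by simp [X, hj]) (by simp)]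
      by_cases hi : i = i'
      · subst hi
        simp only [X, conjTranspose_apply, of_apply, if_true, Complex.star_def, Complex.conj_ofReal]
        rw [← Complex.ofReal_mul]
        congr 1
        calc _ = (√(p k) * √(p k)) * (√(b (π k i)) * √(b (π k i))) * (√(a i) * √(a i))⁻¹ := by
              rw [mul_inv]; ring
          _ = _ := by
              rw [Real.mul_self_sqrt (hp k), Real.mul_self_sqrt (hb _), Real.mul_self_sqrt (ha i)]
      · simp [X, hi]
    simp only [h₁]
    by_cases hi : i = i'
    · subst hi
      simp only [if_true, diagonal_apply_eq]
      rw [← Complex.ofReal_sum, ← Finset.sum_mul, ← hab]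
      by_cases h0 : a i = 0 <;> simp [h0]
    · simp [hi]
  have hXaX : ∀ k, X k * diagonal (fun i => (a i : ℂ)) * (X k)ᴴ =
      (p k : ℂ) • diagonal (fun j => (b j : ℂ)) := by
    intro k
    ext j j'
    rw [Matrix.mul_apply, Finset.sum_eq_single ((π k).symm j)
      (fun i _ hi => by
        have : j ≠ π k i := fun h => hi (by simp [h])
        simp [X, Matrix.mul_diagonal, this]) (by simp)]
    by_cases hj : j' = j
    · subst hj
      simp only [X, conjTranspose_apply, of_apply, if_true, Complex.star_def, Complex.conj_ofReal,
        Equiv.apply_symm_apply, Matrix.smul_apply, diagonal_apply_eq, Matrix.mul_diagonal, smul_eq_mul]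
      rw [← Complex.ofReal_mul, ← Complex.ofReal_mul, ← Complex.ofReal_mul]
      congr 1
      calc _ = (√(p k) * √(p k)) * (√(b j') * √(b j')) *
            ((√(a ((π k).symm j')) * √(a ((π k).symm j')))⁻¹ * a ((π k).symm j')) := by
              rw [mul_inv]; ring
        _ = _ := by
          rw [Real.mul_self_sqrt (hp k), Real.mul_self_sqrt (hb _), Real.mul_self_sqrt (ha _)]
          by_cases h0 : a ((π k).symm j') = 0
          · have := hpb _ h0 k
            simp only [Equiv.apply_symm_apply] at this
            rw [this, zero_mul]
          · rw [inv_mul_cancel₀ h0, mul_one]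
    · simp [X, hj, Ne.symm hj]
  have hconj : ∀ Y Z : Matrix A A ℂ, U * Y * Uᴴ * (U * Z * Uᴴ) = U * (Y * Z) * Uᴴ := by
    intro Y Z
    rw [show U * Y * Uᴴ * (U * Z * Uᴴ) = U * (Y * (Uᴴ * U) * Z) * Uᴴ by simp only [Matrix.mul_assoc],
      hM.1, Matrix.mul_one]
  set R : Matrix A A ℂ := U * diagonal (fun i => if a i = 0 then 0 else 1) * Uᴴ with hR
  have hK : ∑ k, (V * X k * Uᴴ)ᴴ * (V * X k * Uᴴ) = R := by
    rw [hR, ← hXX, Matrix.mul_sum, Matrix.sum_mul]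
    refine Finset.sum_congr rfl fun k _ => ?_
    calc _ = U * ((X k)ᴴ * (Vᴴ * V) * X k) * Uᴴ := by
          simp only [conjTranspose_mul, conjTranspose_conjTranspose, Matrix.mul_assoc]
      _ = _ := by rw [hN.1, Matrix.mul_one]
  have hRR : R * R = R := by
    rw [hR, hconj, diagonal_mul_diagonal]
    congr
    ext i
    by_cases hi : a i = 0 <;> simp [hi]
  have hRM : R * M = M := by
    refine eq_of_mul_conjTranspose_eq ?_
    rw [hM.2, hR, hconj, diagonal_mul_diagonal]
    congr
    ext i
    by_cases hi : a i = 0 <;> simp [hi]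
  have := Convertible.alice_pureOp (σ := fun k => (p k : ℂ) • pureOp N)
    (fun k => V * X k * Uᴴ) hK hRR hRM fun k => ?_
  · simpa [Finset.sum_smul] using this
  · have : (p k : ℂ) • pureOp N = pureOp ((√(p k) : ℂ) • N) := by
      rw [pureOp_real_smul, Real.sq_sqrt (hp k)]
    rw [this]
    -- After outcome `k` Alice's marginal is already that of `√(p k) • N`; only a correction by Bob
    -- remains.
    refine Convertible.of_marginal_eq ?_
    calc V * X k * Uᴴ * M * (V * X k * Uᴴ * M)ᴴ = V * X k * Uᴴ * (M * Mᴴ) * (U * (X k)ᴴ * Vᴴ) := by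
          simp only [conjTranspose_mul, conjTranspose_conjTranspose, Matrix.mul_assoc]
      _ = V * (X k * (Uᴴ * U) * diagonal (fun i => (a i : ℂ)) * (Uᴴ * U) * (X k)ᴴ) * Vᴴ := by
          rw [hM.2]
          simp only [Matrix.mul_assoc]
      _ = (p k : ℂ) • (N * Nᴴ) := by
          rw [hM.1, Matrix.mul_one, Matrix.mul_one, hXaX, hN.2]
          simp
      _ = _ := by
          rw [conjTranspose_smul, Matrix.smul_mul, Matrix.mul_smul, smul_smul]
          congr 1
          rw [Complex.star_def, Complex.conj_ofReal, ← Complex.ofReal_mul,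
            Real.mul_self_sqrt (hp k)]

/-! ### One-shot approximate conversion -/

/-- If `α`, restricted to `T`, is flatter than `β`, restricted to `S`, then it is a mixture of
permutations of the latter. -/
theorem exists_mixture_of_flat {X : Type*} [Fintype X] [DecidableEq X] {α β : X → ℝ}
    (hα : ∀ i, 0 ≤ α i) {T S : Finset X} (hT : 0 < ∑ i ∈ T, α i)
    (hS : 0 < ∑ i ∈ S, β i) (hflat : ∀ i ∈ T, α i * S.card ≤ ∑ i ∈ T, α i) :
    ∃ p : Equiv.Perm X → ℝ, (∀ π, 0 ≤ p π) ∧ ∑ π, p π = (∑ i ∈ T, α i) / ∑ i ∈ S, β i ∧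
      ∀ i, (if i ∈ T then α i else 0) = ∑ π, p π * (if π i ∈ S then β (π i) else 0) := by
  set P := ∑ i ∈ T, α i with hP
  set Q := ∑ i ∈ S, β i with hQ
  set γ : X → ℝ := fun i => if i ∈ T then α i / P else 0 with hγ
  have hγ0 : ∀ i, 0 ≤ γ i := by
    intro i
    simp only [hγ]
    split_ifs
    · exact div_nonneg (hα i) hT.le
    · exact le_rfl
  have hγ1 : ∑ i, γ i = 1 := by
    simp only [hγ]
    rw [Finset.sum_ite_mem, Finset.univ_inter, ← Finset.sum_div, div_self hT.ne']
  have hγS : ∀ i, S.card * γ i ≤ 1 := by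
    intro i
    simp only [hγ]
    split_ifs with hi
    · rw [← mul_div_assoc, div_le_one hT, mul_comm]
      exact hflat i hi
    · simp
  have hcompl : (Sᶜ.card : ℝ) = Fintype.card X - S.card := by
    rw [Finset.card_compl, Nat.cast_sub (Finset.card_le_univ S)]
  have hdef : ∑ i, (1 - S.card * γ i) = Sᶜ.card := by
    rw [Finset.sum_sub_distrib, ← Finset.mul_sum, hγ1, hcompl]
    simp
  -- If `S` is everything, the division by `Sᶜ.card` below returns zero, and no row mass is missing
  -- either.
  have hzero : (Sᶜ.card : ℝ) = 0 → ∀ i, 1 - S.card * γ i = 0 := by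
    intro h0 i
    rw [h0, Finset.sum_eq_zero_iff_of_nonneg fun i _ => sub_nonneg.mpr (hγS i)] at hdef
    exact hdef i (Finset.mem_univ i)
  -- All columns in `S` equal the normalized truncation `γ` of `α`, so `D` maps every vector
  -- supported on `S` to a multiple of `γ`. Flatness leaves a nonnegative remainder in each row,
  -- spread evenly over the other columns. Birkhoff's theorem then supplies the permutations.
  set D : Matrix X X ℝ := Matrix.of fun i j =>
    if j ∈ S then γ i else (1 - S.card * γ i) / Sᶜ.card with hD
  have hDmem : D ∈ doublyStochastic ℝ X := by
    rw [mem_doublyStochastic_iff_sum]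
    refine ⟨fun i j => ?_, fun i => ?_, fun j => ?_⟩
    · simp only [hD, of_apply]
      split_ifs
      · exact hγ0 i
      · exact div_nonneg (sub_nonneg.mpr (hγS i)) (Nat.cast_nonneg _)
    · simp only [hD, of_apply]
      rw [← Finset.sum_add_sum_compl S, Finset.sum_congr rfl fun j hj => if_pos hj,
        Finset.sum_congr rfl fun j hj => if_neg (Finset.mem_compl.mp hj)]
      simp only [Finset.sum_const, nsmul_eq_mul]
      by_cases h0 : (Sᶜ.card : ℝ) = 0
      · have := hzero h0 i
        rw [h0]
        linarith
      · rw [mul_div_cancel₀ _ h0]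
        ring
    · simp only [hD, of_apply]
      by_cases hj : j ∈ S
      · simp only [hj, if_true, hγ1]
      · simp only [hj, if_false]
        rw [← Finset.sum_div, hdef, div_self]
        have : 0 < Sᶜ.card := Finset.card_pos.mpr ⟨j, Finset.mem_compl.mpr hj⟩
        positivity
  obtain ⟨w, hw0, hw1, hw⟩ := exists_eq_sum_perm_of_mem_doublyStochastic hDmem
  refine ⟨fun π => P / Q * w π, fun π => mul_nonneg (div_pos hT hS).le (hw0 π), ?_, fun i => ?_⟩
  · rw [← Finset.mul_sum, hw1, mul_one]
  · have h₁ : ∀ y : X → ℝ, ∑ π, w π * y (π i) = ∑ j, D i j * y j := by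
      intro y
      rw [← hw]
      simp only [Matrix.sum_apply, Matrix.smul_apply, smul_eq_mul, Finset.sum_mul,
        Equiv.Perm.permMatrix, PEquiv.toMatrix_apply, Equiv.toPEquiv_apply]
      rw [Finset.sum_comm]
      refine Finset.sum_congr rfl fun π _ => ?_
      rw [Finset.sum_eq_single (π i) (fun j _ hj => by simp [hj.symm]) (by simp)]
      simp
    simp only [mul_assoc]
    rw [← Finset.mul_sum, h₁ fun j => if j ∈ S then β j else 0]
    have h₂ : ∑ j, D i j * (if j ∈ S then β j else 0) = γ i * Q := by
      simp only [mul_ite, mul_zero, Finset.sum_ite_mem, Finset.univ_inter]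
      rw [hQ, Finset.mul_sum]
      exact Finset.sum_congr rfl fun j hj => by simp [hD, hj]
    rw [h₂]
    simp only [hγ]
    split_ifs
    · field_simp
    · simp

section OneShot

variable {X Y Y' : Type} [Fintype X] [DecidableEq X] [Fintype Y] [DecidableEq Y] [Fintype Y']

/-- With `s = -1` and `s = 1`, the difference and the sum of a filtered vector and the original are
again filtered vectors, so their norms are weighted sums of Schmidt weights. -/
theorem filter_add_smul {X Y : Type*} [Fintype X] [DecidableEq X] {U : Matrix X X ℂ}
    (hU : Uᴴ * U = 1) (M : Matrix X Y ℂ) (c : X → ℝ) (s : ℝ) :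
    U * diagonal (fun i => (c i : ℂ)) * Uᴴ * M + (s : ℂ) • M =
      U * diagonal (fun i => ((c i + s : ℝ) : ℂ)) * Uᴴ * M := by
  have h : diagonal (fun i => ((c i + s : ℝ) : ℂ)) =
      diagonal (fun i => (c i : ℂ)) + (s : ℂ) • (1 : Matrix X X ℂ) := by
    rw [smul_one_eq_diagonal, diagonal_add]
    simp
  rw [h, Matrix.mul_add, Matrix.add_mul, Matrix.add_mul]
  simp [mul_eq_one_comm.mp hU]

theorem sum_compl_weights {X : Type*} [Fintype X] [DecidableEq X] {α : X → ℝ} (hα : ∑ i, α i = 1)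
    (T : Finset X) : ∑ i, (if i ∈ T then 0 else α i) = 1 - ∑ i ∈ T, α i := by
  rw [← hα, ← Finset.sum_add_sum_compl T α, add_sub_cancel_left, ← Finset.sum_add_sum_compl T,
    Finset.sum_congr rfl fun i hi => if_pos hi,
    Finset.sum_congr rfl fun i hi => if_neg (Finset.mem_compl.mp hi)]
  simp

theorem TraceBound.smul_abs {n : Type*} [Fintype n] {c : ℝ} {X : Matrix n n ℂ}
    (h : TraceBound c X) (r : ℝ) : TraceBound (|r| * c) ((r : ℂ) • X) := by
  rcases le_total 0 r with hr | hr
  · rw [abs_of_nonneg hr]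
    exact h.smul hr
  · rw [abs_of_nonpos hr]
    simpa using (h.smul (neg_nonneg.mpr hr)).neg

theorem exists_convertible_of_flat [Nonempty X] [Nonempty Y'] {M : Matrix X Y ℂ}
    {N : Matrix X Y' ℂ} {U V : Matrix X X ℂ} {α β : X → ℝ} (hM : HasSchmidtWeights M U α)
    (hN : HasSchmidtWeights N V β) {T S : Finset X} (hT : 0 < ∑ i ∈ T, α i)
    (hS : 0 < ∑ i ∈ S, β i) (hflat : ∀ i ∈ T, α i * S.card ≤ ∑ i ∈ T, α i) :
    Convertible (pureOp (U * diagonal (fun i => ((if i ∈ T then 1 else 0 : ℝ) : ℂ)) * Uᴴ * M))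
      ((((∑ i ∈ T, α i) / ∑ i ∈ S, β i : ℝ) : ℂ) •
        pureOp (V * diagonal (fun i => ((if i ∈ S then 1 else 0 : ℝ) : ℂ)) * Vᴴ * N)) := by
  obtain ⟨p, hp, hsum, hmix⟩ := exists_mixture_of_flat hM.nonneg hT hS hflat
  rw [← hsum]
  refine Convertible.of_mixture (hM.filter _) (hN.filter _) p hp id fun i => ?_
  simpa [ite_mul] using hmix i

/-- Alice measures whether the Schmidt index lies in `T`. If so, the truncated `M` goes to the
truncated `N`; if not, the state is left alone, at a weight of at most `η`. -/
theorem exists_convertible_near [Nonempty X] [Nonempty Y] {M N : Matrix X Y ℂ}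
    {U V : Matrix X X ℂ} {α β : X → ℝ} (hM : HasSchmidtWeights M U α)
    (hN : HasSchmidtWeights N V β) (hα : ∑ i, α i = 1) (hβ : ∑ i, β i = 1) {T S : Finset X}
    {η : ℝ} (hη : 0 < η) (hη' : η ≤ 1 / 2) (hT : 1 - η ≤ ∑ i ∈ T, α i)
    (hS : 1 - η ≤ ∑ i ∈ S, β i) (hflat : ∀ i ∈ T, α i * S.card ≤ ∑ i ∈ T, α i) :
    ∃ Γ : Matrix (X × Y) (X × Y) ℂ, Convertible (pureOp M) Γ ∧
      TraceBound (7 * √η) (Γ - pureOp N) := by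
  set P := ∑ i ∈ T, α i with hP
  set Q := ∑ i ∈ S, β i with hQ
  have hP0 : 0 < P := by linarith
  have hQ0 : 0 < Q := by linarith
  have hP1 : P ≤ 1 := hα ▸ Finset.sum_le_univ_sum_of_nonneg hM.nonneg
  have hQ1 : Q ≤ 1 := hβ ▸ Finset.sum_le_univ_sum_of_nonneg hN.nonneg
  set MT := U * diagonal (fun i => ((if i ∈ T then 1 else 0 : ℝ) : ℂ)) * Uᴴ with hMT
  set MT' := U * diagonal (fun i => ((if i ∈ T then 0 else 1 : ℝ) : ℂ)) * Uᴴ with hMT'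
  set NS := V * diagonal (fun i => ((if i ∈ S then 1 else 0 : ℝ) : ℂ)) * Vᴴ with hNS
  have hUU : U * Uᴴ = 1 := mul_eq_one_comm.mp hM.1
  have hproj : ∀ c : X → ℝ, (U * diagonal (fun i => (c i : ℂ)) * Uᴴ)ᴴ *
      (U * diagonal (fun i => (c i : ℂ)) * Uᴴ) = U * diagonal (fun i => ((c i ^ 2 : ℝ) : ℂ)) * Uᴴ := by
    intro c
    calc _ = U * (diagonal (fun i => star (c i : ℂ)) * (Uᴴ * U) * diagonal (fun i => (c i : ℂ))) *
          Uᴴ := by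
          simp only [conjTranspose_mul, diagonal_conjTranspose, conjTranspose_conjTranspose,
            Matrix.mul_assoc]
          rfl
      _ = _ := by
          rw [hM.1, Matrix.mul_one, diagonal_mul_diagonal]
          congr
          ext i
          simp [sq]
  have hconv : Convertible (pureOp M)
      (((P / Q : ℝ) : ℂ) • pureOp (NS * N) + pureOp (MT' * M)) := by
    have := Convertible.alice (ι := Bool) (fun b => if b then MT else MT') (ρ := pureOp M)
      (σ := fun b => if b then ((P / Q : ℝ) : ℂ) • pureOp (NS * N) else pureOp (MT' * M)) ?_ ?_
    · simpa using this
    · simp only [Fintype.sum_bool, if_true, Bool.false_eq_true, if_false]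
      rw [hMT, hMT', hproj, hproj, ← Matrix.add_mul, ← Matrix.mul_add, diagonal_add]
      rw [show (fun i => (((if i ∈ T then 1 else 0 : ℝ) ^ 2 : ℝ) : ℂ) +
        (((if i ∈ T then 0 else 1 : ℝ) ^ 2 : ℝ) : ℂ)) = fun _ => 1 by
          ext i
          split_ifs <;> simp]
      simp [hUU]
    · rintro (_ | _)
      · simpa [conjBy_pureOp_left] using Convertible.refl _
      · simp only [if_true, conjBy_pureOp_left]
        exact exists_convertible_of_flat hM hN hP0 hQ0 hflat
  refine ⟨_, hconv, ?_⟩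
  have hsq : 0 < √η := Real.sqrt_pos.mpr hη
  have hη1 : η ≤ √η := by
    have := Real.sq_sqrt hη.le
    nlinarith [Real.sqrt_le_one.mpr (show η ≤ 1 by linarith)]
  have hnear : TraceBound (√η * 2) (pureOp (NS * N) - pureOp N) := by
    refine TraceBound.pureOp_sub hsq two_pos ?_ ?_
    · have h₁ : NS * N - N = V * diagonal (fun i => (((if i ∈ S then 1 else 0) - 1 : ℝ) : ℂ)) * Vᴴ * N := by
        simpa [sub_eq_add_neg] using filter_add_smul hN.1 N (fun i => if i ∈ S then 1 else 0) (-1)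
      rw [h₁, (hN.filter _).trace, Complex.ofReal_re, Real.sq_sqrt hη.le]
      calc _ = ∑ i, (if i ∈ S then 0 else β i) := by
            refine Finset.sum_congr rfl fun i _ => ?_
            split_ifs <;> simp
        _ ≤ η := by
            rw [sum_compl_weights hβ]
            linarith
    · have h₁ : NS * N + N = V * diagonal (fun i => (((if i ∈ S then 1 else 0) + 1 : ℝ) : ℂ)) * Vᴴ * N := by
        simpa using filter_add_smul hN.1 N (fun i => if i ∈ S then 1 else 0) 1
      rw [h₁, (hN.filter _).trace, Complex.ofReal_re]
      calc _ ≤ ∑ i, 2 ^ 2 * β i := by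
            refine Finset.sum_le_sum fun i _ => mul_le_mul_of_nonneg_right ?_ (hN.nonneg i)
            split_ifs <;> norm_num
        _ = 2 ^ 2 := by rw [← Finset.mul_sum, hβ, mul_one]
  have hfail : TraceBound η (pureOp (MT' * M)) := by
    refine (TraceBound.of_posSemidef (posSemidef_pureOp _)).mono ?_
    rw [(hM.filter _).trace, Complex.ofReal_re]
    calc _ = ∑ i, (if i ∈ T then 0 else α i) := by
          refine Finset.sum_congr rfl fun i _ => ?_
          split_ifs <;> simp
      _ ≤ η := by
          rw [sum_compl_weights hα]
          linarith
  have hres : TraceBound (2 * η) (((P / Q - 1 : ℝ) : ℂ) • pureOp N) := by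
    have h₁ : TraceBound 1 (pureOp N) :=
      (TraceBound.of_posSemidef (posSemidef_pureOp _)).mono (by rw [hN.trace, hβ]; simp)
    refine (h₁.smul_abs _).mono ?_
    rw [mul_one, div_sub_one hQ0.ne', abs_div, abs_of_pos hQ0, div_le_iff₀ hQ0, abs_le]
    constructor <;> nlinarith
  have htot := ((hnear.smul (div_pos hP0 hQ0).le).add hres).add hfail
  have : ((P / Q : ℝ) : ℂ) • pureOp (NS * N) + pureOp (MT' * M) - pureOp N =
      ((P / Q : ℝ) : ℂ) • (pureOp (NS * N) - pureOp N) + ((P / Q - 1 : ℝ) : ℂ) • pureOp N +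
        pureOp (MT' * M) := by
    push_cast
    rw [smul_sub, sub_smul, one_smul]
    abel
  rw [this]
  -- The truncation of `N` costs `P / Q * 2√η ≤ 4√η`, the normalization `2η` and the failure branch
  -- `η`; with `η ≤ √η` this makes `7√η`.
  refine htot.mono ?_
  have hPQ : P / Q ≤ 2 := by
    rw [div_le_iff₀ hQ0]
    linarith
  nlinarith

end OneShot

/-! ### Tensor powers -/

/-- The `n`-fold tensor power of a matrix. -/
def tensorPow {A B : Type*} (n : ℕ) (M : Matrix A B ℂ) : Matrix (Fin n → A) (Fin n → B) ℂ :=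
  Matrix.of fun x y => ∏ i, M (x i) (y i)

theorem tensorPow_mul {A B C : Type*} [Fintype B] (n : ℕ) (M : Matrix A B ℂ) (N : Matrix B C ℂ) :
    tensorPow n (M * N) = tensorPow n M * tensorPow n N := by
  ext x z
  simp only [tensorPow, of_apply, Matrix.mul_apply, ← Finset.prod_mul_distrib]
  rw [Finset.prod_univ_sum, Fintype.piFinset_univ]

theorem tensorPow_conjTranspose {A B : Type*} (n : ℕ) (M : Matrix A B ℂ) :
    tensorPow n Mᴴ = (tensorPow n M)ᴴ := by
  ext x y
  simp [tensorPow]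

theorem tensorPow_diagonal {A : Type*} [DecidableEq A] (n : ℕ) (d : A → ℂ) :
    tensorPow n (diagonal d) = diagonal fun x => ∏ i, d (x i) := by
  ext x y
  by_cases h : x = y
  · subst h
    simp [tensorPow]
  · obtain ⟨i, hi⟩ := Function.ne_iff.mp h
    rw [diagonal_apply_ne _ h]
    exact Finset.prod_eq_zero (Finset.mem_univ i) (diagonal_apply_ne _ hi)

theorem tensorPow_one {A : Type*} [DecidableEq A] (n : ℕ) :
    tensorPow n (1 : Matrix A A ℂ) = 1 := by
  rw [← diagonal_one, tensorPow_diagonal]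
  simp

theorem HasSchmidtWeights.pow {A B : Type*} [Fintype A] [DecidableEq A] [Fintype B]
    {M : Matrix A B ℂ} {U : Matrix A A ℂ} {a : A → ℝ} (h : HasSchmidtWeights M U a) (n : ℕ) :
    HasSchmidtWeights (tensorPow n M) (tensorPow n U) fun x => ∏ i, a (x i) := by
  constructor
  · rw [← tensorPow_conjTranspose, ← tensorPow_mul, h.1, tensorPow_one]
  · rw [← tensorPow_conjTranspose, ← tensorPow_mul, h.2, tensorPow_mul, tensorPow_mul,
      tensorPow_diagonal, tensorPow_conjTranspose]
    simp

/-! ### Typical sequences -/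

section Typical

variable {A : Type*} [Fintype A]

theorem sum_cons {n : ℕ} (F : (Fin (n + 1) → A) → ℝ) :
    ∑ x, F x = ∑ a, ∑ x : Fin n → A, F (Fin.cons a x) := by
  rw [← (Fin.consEquiv fun _ : Fin (n + 1) => A).sum_comp, Fintype.sum_prod_type]
  rfl

theorem sum_prod_eq_one {a : A → ℝ} (ha : ∑ i, a i = 1) (n : ℕ) :
    ∑ x : Fin n → A, ∏ i, a (x i) = 1 := by
  induction n with
  | zero => simp
  | succ n ih =>
    rw [sum_cons]
    simp [Fin.prod_univ_succ, ← Finset.mul_sum, ih, ha]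

theorem sum_prod_mul_sum {a f : A → ℝ} (ha : ∑ i, a i = 1) (hf : ∑ i, a i * f i = 0) (n : ℕ) :
    ∑ x : Fin n → A, (∏ i, a (x i)) * ∑ i, f (x i) = 0 := by
  induction n with
  | zero => simp
  | succ n ih =>
    rw [sum_cons]
    simp only [Fin.prod_univ_succ, Fin.sum_univ_succ, Fin.cons_zero, Fin.cons_succ]
    have h : ∀ b, ∑ x : Fin n → A, (a b * ∏ i, a (x i)) * (f b + ∑ i, f (x i)) = a b * f b := by
      intro b
      calc _ = ∑ x : Fin n → A, (a b * f b * (∏ i, a (x i)) +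
            a b * ((∏ i, a (x i)) * ∑ i, f (x i))) := Finset.sum_congr rfl fun x _ => by ring
        _ = _ := by
          rw [Finset.sum_add_distrib, ← Finset.mul_sum, ← Finset.mul_sum, ih, sum_prod_eq_one ha]
          ring
    rw [Finset.sum_congr rfl fun b _ => h b, hf]

/-- Variances of independent centred variables add: the cross term vanishes by `sum_prod_mul_sum`.
-/
theorem sum_prod_mul_sum_sq {a f : A → ℝ} (ha : ∑ i, a i = 1) (hf : ∑ i, a i * f i = 0) (n : ℕ) :
    ∑ x : Fin n → A, (∏ i, a (x i)) * (∑ i, f (x i)) ^ 2 = n * ∑ i, a i * f i ^ 2 := by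
  induction n with
  | zero => simp
  | succ n ih =>
    rw [sum_cons]
    simp only [Fin.prod_univ_succ, Fin.sum_univ_succ, Fin.cons_zero, Fin.cons_succ]
    have h : ∀ b, ∑ x : Fin n → A, (a b * ∏ i, a (x i)) * (f b + ∑ i, f (x i)) ^ 2 =
        a b * f b ^ 2 + a b * (n * ∑ i, a i * f i ^ 2) := by
      intro b
      calc _ = ∑ x : Fin n → A, (a b * f b ^ 2 * (∏ i, a (x i)) +
            2 * a b * f b * ((∏ i, a (x i)) * ∑ i, f (x i)) +
            a b * ((∏ i, a (x i)) * (∑ i, f (x i)) ^ 2)) :=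
            Finset.sum_congr rfl fun x _ => by ring
        _ = _ := by
          rw [Finset.sum_add_distrib, Finset.sum_add_distrib, ← Finset.mul_sum, ← Finset.mul_sum,
            ← Finset.mul_sum, ih, sum_prod_mul_sum ha hf, sum_prod_eq_one ha]
          ring
    rw [Finset.sum_congr rfl fun b _ => h b, Finset.sum_add_distrib, ← Finset.sum_mul, ha]
    push_cast
    ring

/-- The Shannon entropy, in nats. -/
def shannonEntropy (a : A → ℝ) : ℝ := ∑ i, Real.negMulLog (a i)

/-- The asymptotic equipartition property. -/
theorem exists_typical_set {a : A → ℝ} (ha0 : ∀ i, 0 ≤ a i) (ha : ∑ i, a i = 1) {δ η : ℝ}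
    (hδ : 0 < δ) (hη : 0 < η) : ∃ n₀ : ℕ, ∀ n ≥ n₀, ∃ T : Finset (Fin n → A),
      1 - η ≤ ∑ x ∈ T, ∏ i, a (x i) ∧
      ∀ x ∈ T, Real.exp (-(n * (shannonEntropy a + δ))) ≤ ∏ i, a (x i) ∧
        ∏ i, a (x i) ≤ Real.exp (-(n * (shannonEntropy a - δ))) := by
  classical
  set f : A → ℝ := fun i => -Real.log (a i) - shannonEntropy a with hf
  have hf0 : ∑ i, a i * f i = 0 := by
    simp only [hf, mul_sub, Finset.sum_sub_distrib, ← Finset.sum_mul, ha, one_mul]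
    rw [sub_eq_zero]
    exact Finset.sum_congr rfl fun i _ => by simp [Real.negMulLog]
  set v := ∑ i, a i * f i ^ 2 with hv
  have hv0 : 0 ≤ v := Finset.sum_nonneg fun i _ => mul_nonneg (ha0 i) (sq_nonneg _)
  -- Chebyshev's inequality bounds the mass of atypical sequences by `v / (n * δ ^ 2)`.
  obtain ⟨n₀, hn₀⟩ := exists_nat_gt (v / (δ ^ 2 * η))
  refine ⟨n₀ + 1, fun n hn => ?_⟩
  have hn0 : (0 : ℝ) < n := by
    have : 0 < n := by omega
    exact_mod_cast this
  have hnv : v ≤ n * (δ ^ 2 * η) := by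
    have h₁ : v < n₀ * (δ ^ 2 * η) := (div_lt_iff₀ (by positivity)).mp hn₀
    have h₂ : (n₀ : ℝ) ≤ n := by exact_mod_cast (by omega : n₀ ≤ n)
    have h₃ : (n₀ : ℝ) * (δ ^ 2 * η) ≤ n * (δ ^ 2 * η) := by gcongr
    linarith
  have hw0 : ∀ x : Fin n → A, 0 ≤ ∏ i, a (x i) := fun x => Finset.prod_nonneg fun i _ => ha0 _
  -- Since `Real.log 0 = 0`, sequences of weight zero could pass the first test; they carry no mass
  -- and are excluded explicitly.
  set T : Finset (Fin n → A) :=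
    Finset.univ.filter fun x => |∑ i, f (x i)| ≤ n * δ ∧ ∏ i, a (x i) ≠ 0 with hT
  refine ⟨T, ?_, fun x hx => ?_⟩
  · have hcompl : ∑ x ∈ Tᶜ, ∏ i, a (x i) ≤ η := by
      have h₁ : (n * δ) ^ 2 * ∑ x ∈ Tᶜ, ∏ i, a (x i) ≤ n * v := by
        rw [hv, ← sum_prod_mul_sum_sq ha hf0, Finset.mul_sum]
        refine (Finset.sum_le_sum fun x hx => ?_).trans (Finset.sum_le_univ_sum_of_nonneg
          fun x => mul_nonneg (hw0 x) (sq_nonneg _))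
        simp only [hT, Finset.mem_compl, Finset.mem_filter, Finset.mem_univ, true_and, not_and,
          not_not] at hx
        by_cases h : |∑ i, f (x i)| ≤ n * δ
        · rw [hx h]
          simp
        · rw [mul_comm]
          refine mul_le_mul_of_nonneg_left ?_ (hw0 x)
          rw [← sq_abs (∑ i, f (x i))]
          exact pow_le_pow_left₀ (by positivity) (not_le.mp h).le 2
      have h₂ : (n : ℝ) * v ≤ (n * δ) ^ 2 * η := by
        calc (n : ℝ) * v ≤ n * (n * (δ ^ 2 * η)) := by gcongr
          _ = _ := by ring
      exact le_of_mul_le_mul_left (h₁.trans h₂) (by positivity)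
    have := Finset.sum_add_sum_compl T fun x : Fin n → A => ∏ i, a (x i)
    rw [sum_prod_eq_one ha] at this
    linarith
  · simp only [hT, Finset.mem_filter, Finset.mem_univ, true_and] at hx
    have hpos : 0 < ∏ i, a (x i) := lt_of_le_of_ne (hw0 x) (Ne.symm hx.2)
    have hlog : Real.log (∏ i, a (x i)) = -(∑ i, f (x i)) - n * shannonEntropy a := by
      rw [Real.log_prod fun i _ => Finset.prod_ne_zero_iff.mp hx.2 i (Finset.mem_univ i)]
      simp [hf, Finset.sum_sub_distrib]
    rw [← Real.le_log_iff_exp_le hpos, ← Real.log_le_iff_le_exp hpos, hlog]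
    have := abs_le.mp hx.1
    constructor <;> linarith

end Typical

/-! ### Asymptotic conversion -/

/-- Each weight in `T` is at most `exp (-n (H(a) - δ))`, and `S` has at most `exp (n (H(b) + δ))`
elements. With `δ` a quarter of the gap the product is at most `exp (-2nδ)`, which is eventually
below the mass of `T`. -/
theorem exists_convertible_tensorPow {A B : Type} [Fintype A] [DecidableEq A]
    [Fintype B] [DecidableEq B] [Nonempty A] [Nonempty B] {M N : Matrix A B ℂ}
    {U V : Matrix A A ℂ} {a b : A → ℝ} (hM : HasSchmidtWeights M U a)
    (hN : HasSchmidtWeights N V b) (ha : ∑ i, a i = 1) (hb : ∑ i, b i = 1)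
    (hab : shannonEntropy b < shannonEntropy a) {c : ℝ} (hc : 0 < c) :
    ∃ (n : ℕ) (Γ : Matrix ((Fin (n + 1) → A) × (Fin (n + 1) → B))
        ((Fin (n + 1) → A) × (Fin (n + 1) → B)) ℂ),
      Convertible (pureOp (tensorPow (n + 1) M)) Γ ∧
        TraceBound c (Γ - pureOp (tensorPow (n + 1) N)) := by
  set η := min (1 / 2) ((c / 7) ^ 2) with hη
  have hη0 : 0 < η := lt_min (by norm_num) (by positivity)
  have hηc : 7 * √η ≤ c := by
    have : √η ≤ c / 7 := by
      rw [Real.sqrt_le_left (by positivity)]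
      exact min_le_right _ _
    linarith
  set δ := (shannonEntropy a - shannonEntropy b) / 4 with hδ
  have hδ0 : 0 < δ := by
    rw [hδ]
    linarith
  obtain ⟨n₁, h₁⟩ := exists_typical_set hM.nonneg ha hδ0 hη0
  obtain ⟨n₂, h₂⟩ := exists_typical_set hN.nonneg hb hδ0 hη0
  obtain ⟨n₃, h₃⟩ := exists_nat_gt (Real.log 2 / (2 * δ))
  set n := n₁ + n₂ + n₃ with hn
  obtain ⟨T, hT, hT'⟩ := h₁ (n + 1) (by omega)
  obtain ⟨S, hS, hS'⟩ := h₂ (n + 1) (by omega)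
  have hflat : ∀ x ∈ T, (∏ i, a (x i)) * S.card ≤ ∑ x ∈ T, ∏ i, a (x i) := by
    intro x hx
    have hcard : (S.card : ℝ) * Real.exp (-((n + 1 : ℕ) * (shannonEntropy b + δ))) ≤ 1 := by
      calc _ = ∑ x ∈ S, Real.exp (-((n + 1 : ℕ) * (shannonEntropy b + δ))) := by simp
        _ ≤ ∑ x ∈ S, ∏ i, b (x i) := Finset.sum_le_sum fun x hx => (hS' x hx).1
        _ ≤ ∑ x : Fin (n + 1) → A, ∏ i, b (x i) :=
          Finset.sum_le_univ_sum_of_nonneg fun x => Finset.prod_nonneg fun i _ => hN.nonneg _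
        _ = 1 := sum_prod_eq_one hb _
    have hlarge : Real.exp (-((n + 1 : ℕ) * (2 * δ))) ≤ 1 / 2 := by
      rw [← Real.le_log_iff_exp_le (by norm_num), one_div, Real.log_inv]
      have h₄ : Real.log 2 < n₃ * (2 * δ) := (div_lt_iff₀ (by positivity)).mp h₃
      have h₅ : (n₃ : ℝ) ≤ (n + 1 : ℕ) := by exact_mod_cast (by omega : n₃ ≤ n + 1)
      have h₆ : (n₃ : ℝ) * (2 * δ) ≤ (n + 1 : ℕ) * (2 * δ) := by gcongr
      linarith
    have hhalf : (1 : ℝ) / 2 ≤ 1 - η := by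
      have := min_le_left (1 / 2) ((c / 7) ^ 2)
      linarith
    calc (∏ i, a (x i)) * S.card ≤
          Real.exp (-((n + 1 : ℕ) * (shannonEntropy a - δ))) * S.card := by
          gcongr
          exact (hT' x hx).2
      _ = Real.exp (-((n + 1 : ℕ) * (2 * δ))) *
          (S.card * Real.exp (-((n + 1 : ℕ) * (shannonEntropy b + δ)))) := by
          rw [mul_left_comm, ← Real.exp_add, mul_comm]
          congr 2
          rw [hδ]
          ring
      _ ≤ 1 / 2 * 1 := by gcongr
      _ ≤ _ := by linarith
  obtain ⟨Γ, hΓ, hΓ'⟩ := exists_convertible_near (hM.pow (n + 1)) (hN.pow (n + 1))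
    (sum_prod_eq_one ha _) (sum_prod_eq_one hb _) hη0 (min_le_left _ _) hT hS hflat
  exact ⟨n, Γ, hΓ, hΓ'.mono hηc⟩

/-! ### Catalysts -/

/-- With the catalyst `τ`, the state `ρ` can be transformed into a state close to `σ`, returning
the catalyst exactly. -/
def Catalyzes {A B A' B' : Type} [Fintype A] [Fintype B] [Fintype A'] [Fintype B']
    (τ : Matrix (A' × B') (A' × B') ℂ) (ρ σ : Matrix (A × B) (A × B) ℂ) (c : ℝ) : Prop :=
  ∃ ω : Matrix ((A × A') × (B × B')) ((A × A') × (B × B')) ℂ,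
    Convertible (withCatalyst ρ τ) ω ∧ traceSystem ω = τ ∧ TraceBound c (ω - withCatalyst σ τ)

section Flag

variable {ι A B R R' : Type} [DecidableEq ι] [Fintype A] [DecidableEq A] [Fintype B]
  [DecidableEq B] [Fintype R] [DecidableEq R] [Fintype R'] [DecidableEq R']

/-- The isometry by which Alice attaches a classical register in the state `k`. -/
def flagMatrix (A R : Type) [DecidableEq A] [DecidableEq R] (k : ι) :
    Matrix (A × (ι × R)) (A × R) ℂ :=
  Matrix.of fun x y => if x = (y.1, (k, y.2)) then 1 else 0

theorem flagMatrix_conjTranspose_mul [Fintype ι] (j k : ι) :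
    (flagMatrix A R j)ᴴ * flagMatrix A R k = if j = k then 1 else 0 := by
  ext ⟨a, r⟩ ⟨a', r'⟩
  rw [Matrix.mul_apply, Finset.sum_eq_single (a, (j, r))
    (fun x _ hx => by simp [flagMatrix, hx]) (by simp)]
  split_ifs with h <;> simp [flagMatrix, h, Matrix.one_apply]

theorem sum_flagMatrix_mul_conjTranspose [Fintype ι] :
    ∑ k : ι, ((flagMatrix A R k)ᴴ)ᴴ * (flagMatrix A R k)ᴴ = 1 := by
  ext ⟨a, i, r⟩ ⟨a', i', r'⟩
  simp only [conjTranspose_conjTranspose]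
  rw [Matrix.sum_apply, Finset.sum_eq_single i (fun k _ hk => by
    simp [Matrix.mul_apply, flagMatrix, hk.symm]) (by simp)]
  rw [Matrix.mul_apply, Finset.sum_eq_single (a, r)
    (fun x _ hx => by
      have : ¬ (a = x.1 ∧ r = x.2) := fun h => hx (Prod.ext h.1.symm h.2.symm)
      simp [flagMatrix, this]) (by simp)]
  simp [flagMatrix, Matrix.one_apply, eq_comm]

/-- Attaching a classical register in the state `k` to Alice's part of the catalyst. -/
def flag (k : ι) : Matrix ((A × R) × (B × R')) ((A × R) × (B × R')) ℂ →ₗ[ℂ]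
    Matrix ((A × (ι × R)) × (B × R')) ((A × (ι × R)) × (B × R')) ℂ :=
  conjBy (flagMatrix A R k ⊗ₖ (1 : Matrix (B × R') (B × R') ℂ))

theorem flag_apply (k : ι) (X : Matrix ((A × R) × (B × R')) ((A × R) × (B × R')) ℂ) (a a' : A)
    (i i' : ι) (r r' : R) (s s' : B × R') :
    flag k X ((a, (i, r)), s) ((a', (i', r')), s') =
      if i = k ∧ i' = k then X ((a, r), s) ((a', r'), s') else 0 := by
  rw [flag, conjBy_kronecker_one_apply]
  rw [Finset.sum_eq_single (a', r') (fun x _ hx => by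
      have : ¬ (a' = x.1 ∧ r' = x.2) := fun h => hx (Prod.ext h.1.symm h.2.symm)
      have h : ¬ (a' = x.1 ∧ i' = k ∧ r' = x.2) := fun h => this ⟨h.1, h.2.2⟩
      simp [flagMatrix, h]) (by simp)]
  rw [Finset.sum_eq_single (a, r) (fun x _ hx => by
      have : ¬ (a = x.1 ∧ r = x.2) := fun h => hx (Prod.ext h.1.symm h.2.symm)
      have h : ¬ (a = x.1 ∧ i = k ∧ r = x.2) := fun h => this ⟨h.1, h.2.2⟩
      simp [flagMatrix, h]) (by simp)]
  by_cases h : i = k <;> by_cases h' : i' = k <;> simp [flagMatrix, h, h']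

theorem flag_posSemidef_and_trace [Fintype ι] (k : ι)
    {X : Matrix ((A × R) × (B × R')) ((A × R) × (B × R')) ℂ} (hX : X.PosSemidef) :
    (flag k X).PosSemidef ∧ (flag k X).trace = X.trace := by
  refine ⟨posSemidef_conjBy _ hX, ?_⟩
  rw [flag, trace_conjBy, conjTranspose_kronecker, ← mul_kronecker_mul,
    flagMatrix_conjTranspose_mul]
  simp

theorem Convertible.flag [Fintype ι] (k : ι) (X : Matrix ((A × R) × (B × R')) ((A × R) × (B × R')) ℂ) :
    Convertible X (flag k X) :=
  .alice_isometry _ (by simp [flagMatrix_conjTranspose_mul]) X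

/-- Protocols may be chosen according to a classical register. -/
theorem Convertible.sum_flag [Fintype ι] {A₁ B₁ : Type}
    {X : ι → Matrix ((A × R) × (B × R')) ((A × R) × (B × R')) ℂ}
    {Y : ι → Matrix (A₁ × B₁) (A₁ × B₁) ℂ} (h : ∀ k, Convertible (X k) (Y k)) :
    Convertible (∑ k, UniversalCatalysis.flag k (X k)) (∑ k, Y k) := by
  refine Convertible.alice (fun k => (flagMatrix A R k)ᴴ) sum_flagMatrix_mul_conjTranspose
    fun k => ?_
  -- The flags are orthogonal: reading `k` removes the register together with all other summands.
  have : conjBy ((flagMatrix A R k)ᴴ ⊗ₖ (1 : Matrix (B × R') (B × R') ℂ))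
      (∑ j, UniversalCatalysis.flag j (X j)) = X k := by
    ext ⟨⟨a, r⟩, s⟩ ⟨⟨a', r'⟩, s'⟩
    rw [conjBy_kronecker_one_apply, Finset.sum_eq_single (a', (k, r'))
      (fun x _ hx => by simp [flagMatrix, hx]) (by simp), Finset.sum_eq_single (a, (k, r))
      (fun x _ hx => by simp [flagMatrix, hx]) (by simp)]
    simp [flagMatrix, Matrix.sum_apply, flag_apply]
  rw [this]
  exact h k

/-- A cyclic sequence of states `ω`, in which every `ω k` is close to the product of `σ` and its
marginal, yields a catalyst as soon as `ρ` together with the marginal of `ω k` can be transformed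
into `ω (k + 1)`. -/
theorem exists_catalyst_of_cycle {n : ℕ} [NeZero n]
    {ω : Fin n → Matrix ((A × R) × (B × R')) ((A × R) × (B × R')) ℂ}
    {ρ σ : Matrix (A × B) (A × B) ℂ} {c : ℝ} (hω : ∀ k, IsDensityMatrix (ω k))
    (hconv : ∀ k, Convertible (withCatalyst ρ (traceSystem (ω k))) (ω (k + 1)))
    (hnear : ∀ k, TraceBound c (ω k - withCatalyst σ (traceSystem (ω k)))) :
    ∃ τ : Matrix ((Fin n × R) × R') ((Fin n × R) × R') ℂ,
      IsDensityMatrix τ ∧ Catalyzes τ ρ σ c := by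
  have hn : (n : ℂ) ≠ 0 := by exact_mod_cast NeZero.ne n
  have hn' : (n : ℝ) ≠ 0 := by exact_mod_cast NeZero.ne n
  set w : ℝ := 1 / n with hw
  have hw0 : 0 ≤ w := by positivity
  -- The catalyst will be the marginal of this uniform labelled mixture, and `Ω` itself the final
  -- state.
  set Ω := ∑ k, flag k ((w : ℂ) • ω k) with hΩ
  have hΩd : IsDensityMatrix Ω := by
    constructor
    · exact posSemidef_sum _ fun k _ =>
        (flag_posSemidef_and_trace k (posSemidef_real_smul (hω k).1 hw0)).1
    · rw [hΩ, Matrix.trace_sum, Finset.sum_congr rfl fun k _ =>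
        (flag_posSemidef_and_trace k (posSemidef_real_smul (hω k).1 hw0)).2]
      simp [(hω _).2, hw, hn]
  have hprod : ∀ χ : Matrix (A × B) (A × B) ℂ, withCatalyst χ (traceSystem Ω) =
      ∑ k, flag k ((w : ℂ) • withCatalyst χ (traceSystem (ω k))) := by
    intro χ
    ext ⟨⟨a, i, r⟩, b, s⟩ ⟨⟨a', i', r'⟩, b', s'⟩
    simp only [hΩ, withCatalyst, traceSystem, of_apply, Matrix.sum_apply, flag_apply,
      Matrix.smul_apply, smul_eq_mul]
    by_cases h : i = i'
    · subst h
      simp [Finset.mul_sum, mul_left_comm]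
    · have : ∀ k, ¬ (i = k ∧ i' = k) := fun k hk => h (hk.1.trans hk.2.symm)
      simp [this]
  refine ⟨traceSystem Ω, hΩd.traceSystem, Ω, ?_, rfl, ?_⟩
  · rw [hprod]
    -- Addition in `Fin n` is cyclic, so advancing every label and every stage by one only reorders
    -- the mixture. Hence the catalyst returns exactly.
    have hcycle : Ω = ∑ k, flag (k + 1) ((w : ℂ) • ω (k + 1)) :=
      (Equiv.sum_comp (Equiv.addRight (1 : Fin n)) fun k => flag k ((w : ℂ) • ω k)).symm
    rw [hcycle]
    exact Convertible.sum_flag fun k => ((hconv k).smul _).trans (.flag _ _)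
  · rw [hprod, hΩ, ← Finset.sum_sub_distrib]
    have : ∀ k ∈ Finset.univ, TraceBound (w * c) (flag k ((w : ℂ) • ω k) -
        flag k ((w : ℂ) • withCatalyst σ (traceSystem (ω k)))) := by
      intro k _
      rw [← map_sub, ← smul_sub]
      exact ((hnear k).smul hw0).map _ fun P hP => flag_posSemidef_and_trace k hP
    refine (TraceBound.sum this).mono ?_
    simp only [Finset.sum_const, Finset.card_univ, Fintype.card_fin, nsmul_eq_mul, hw]
    field_simp
    exact le_rfl

end Flag

/-! ### The catalyst obtained from an asymptotic transformation -/

section Shift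

variable {A B : Type}

/-- The product of the operators `r i`. -/
def prodOp {n : ℕ} (r : Fin n → Matrix (A × B) (A × B) ℂ) :
    Matrix ((Fin n → A) × (Fin n → B)) ((Fin n → A) × (Fin n → B)) ℂ :=
  Matrix.of fun x y => ∏ i, r i (x.1 i, x.2 i) (y.1 i, y.2 i)

theorem prodOp_pureOp (n : ℕ) (M : Matrix A B ℂ) :
    prodOp (fun _ : Fin n => pureOp M) = pureOp (tensorPow n M) := by
  ext
  simp [prodOp, pureOp, tensorPow, Finset.prod_mul_distrib]

/-- Singling out the first copy. -/
def splitFirst {m : ℕ} (X : Matrix ((Fin (m + 1) → A) × (Fin (m + 1) → B))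
    ((Fin (m + 1) → A) × (Fin (m + 1) → B)) ℂ) :
    Matrix ((A × (Fin m → A)) × (B × (Fin m → B))) ((A × (Fin m → A)) × (B × (Fin m → B))) ℂ :=
  X.submatrix (Prod.map (Fin.consEquiv fun _ => A) (Fin.consEquiv fun _ => B))
    (Prod.map (Fin.consEquiv fun _ => A) (Fin.consEquiv fun _ => B))

/-- Singling out the last copy. -/
def splitLast {m : ℕ} (X : Matrix ((Fin (m + 1) → A) × (Fin (m + 1) → B))
    ((Fin (m + 1) → A) × (Fin (m + 1) → B)) ℂ) :
    Matrix ((A × (Fin m → A)) × (B × (Fin m → B))) ((A × (Fin m → A)) × (B × (Fin m → B))) ℂ :=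
  X.submatrix (Prod.map (Fin.snocEquiv fun _ => A) (Fin.snocEquiv fun _ => B))
    (Prod.map (Fin.snocEquiv fun _ => A) (Fin.snocEquiv fun _ => B))

theorem splitLast_prodOp {m : ℕ} (r : Fin (m + 1) → Matrix (A × B) (A × B) ℂ) :
    splitLast (prodOp r) = withCatalyst (r (Fin.last m)) (prodOp (Fin.init r)) := by
  ext ⟨⟨a, x⟩, b, y⟩ ⟨⟨a', x'⟩, b', y'⟩
  simp [splitLast, prodOp, withCatalyst, Fin.prod_univ_castSucc, Fin.init, mul_comm]

/-- Product operators therefore span, and linear maps such as powers of `shift` can be computed on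
them. -/
theorem single_eq_prodOp [DecidableEq A] [DecidableEq B] {n : ℕ}
    (p q : (Fin n → A) × (Fin n → B)) :
    Matrix.single p q (1 : ℂ) =
      prodOp fun i => Matrix.single (p.1 i, p.2 i) (q.1 i, q.2 i) (1 : ℂ) := by
  ext x y
  simp only [prodOp, of_apply, Matrix.single_apply, Finset.prod_ite_zero, Finset.prod_const_one]
  congr 1
  simp only [Prod.ext_iff, funext_iff, Finset.mem_univ, true_implies, forall_and]

theorem Convertible.of_splitFirst [Fintype A] [DecidableEq A] [Fintype B] [DecidableEq B] {m : ℕ}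
    (X : Matrix ((Fin (m + 1) → A) × (Fin (m + 1) → B))
      ((Fin (m + 1) → A) × (Fin (m + 1) → B)) ℂ) : Convertible (splitFirst X) X := by
  convert Convertible.relabel (Fin.consEquiv fun _ : Fin (m + 1) => A).symm
    (Fin.consEquiv fun _ : Fin (m + 1) => B).symm (splitFirst X) using 1
  ext x y
  simp [splitFirst, Prod.map, Fin.consEquiv]

theorem Convertible.splitLast [Fintype A] [DecidableEq A] [Fintype B] [DecidableEq B] {m : ℕ}
    (X : Matrix ((Fin (m + 1) → A) × (Fin (m + 1) → B))
      ((Fin (m + 1) → A) × (Fin (m + 1) → B)) ℂ) :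
    Convertible X (UniversalCatalysis.splitLast X) :=
  Convertible.relabel (Fin.snocEquiv fun _ : Fin (m + 1) => A)
    (Fin.snocEquiv fun _ : Fin (m + 1) => B) X

theorem posSemidef_splitFirst_iff {m : ℕ} {X : Matrix ((Fin (m + 1) → A) × (Fin (m + 1) → B))
    ((Fin (m + 1) → A) × (Fin (m + 1) → B)) ℂ} : (splitFirst X).PosSemidef ↔ X.PosSemidef :=
  posSemidef_submatrix_equiv
    (Equiv.prodCongr (Fin.consEquiv fun _ : Fin (m + 1) => A) (Fin.consEquiv fun _ => B))

variable [Fintype A] [Fintype B]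

theorem trace_splitFirst {m : ℕ} (X : Matrix ((Fin (m + 1) → A) × (Fin (m + 1) → B))
    ((Fin (m + 1) → A) × (Fin (m + 1) → B)) ℂ) : (splitFirst X).trace = X.trace :=
  trace_submatrix X (Equiv.prodCongr (Fin.consEquiv fun _ => A) (Fin.consEquiv fun _ => B))

theorem trace_splitLast {m : ℕ} (X : Matrix ((Fin (m + 1) → A) × (Fin (m + 1) → B))
    ((Fin (m + 1) → A) × (Fin (m + 1) → B)) ℂ) : (splitLast X).trace = X.trace :=
  trace_submatrix X (Equiv.prodCongr (Fin.snocEquiv fun _ => A) (Fin.snocEquiv fun _ => B))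

theorem IsDensityMatrix.splitLast {m : ℕ} {X : Matrix ((Fin (m + 1) → A) × (Fin (m + 1) → B))
    ((Fin (m + 1) → A) × (Fin (m + 1) → B)) ℂ} (hX : IsDensityMatrix X) :
    IsDensityMatrix (splitLast X) :=
  ⟨hX.1.submatrix _, by rw [trace_splitLast, hX.2]⟩

theorem TraceBound.splitLast {m : ℕ} {c : ℝ} {X : Matrix ((Fin (m + 1) → A) × (Fin (m + 1) → B))
    ((Fin (m + 1) → A) × (Fin (m + 1) → B)) ℂ} (hX : TraceBound c X) :
    TraceBound c (splitLast X) :=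
  hX.submatrix (Equiv.prodCongr (Fin.snocEquiv fun _ => A) (Fin.snocEquiv fun _ => B))

/-- Discarding the last copy and inserting a new first copy in the state `ρ`. -/
def shift {m : ℕ} (ρ : Matrix (A × B) (A × B) ℂ) :
    Module.End ℂ (Matrix ((Fin (m + 1) → A) × (Fin (m + 1) → B))
      ((Fin (m + 1) → A) × (Fin (m + 1) → B)) ℂ) where
  toFun X := Matrix.of fun x y => ρ (x.1 0, x.2 0) (y.1 0, y.2 0) *
    traceSystem (splitLast X) (Fin.tail x.1, Fin.tail x.2) (Fin.tail y.1, Fin.tail y.2)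
  map_add' X Y := by
    ext
    simp [traceSystem, splitLast, Finset.sum_add_distrib, mul_add]
  map_smul' c X := by
    ext
    simp [traceSystem, splitLast, ← Finset.mul_sum, mul_left_comm]

theorem splitFirst_shift {m : ℕ} (ρ : Matrix (A × B) (A × B) ℂ)
    (X : Matrix ((Fin (m + 1) → A) × (Fin (m + 1) → B))
      ((Fin (m + 1) → A) × (Fin (m + 1) → B)) ℂ) :
    splitFirst (shift ρ X) = withCatalyst ρ (traceSystem (splitLast X)) := by
  ext ⟨⟨a, x⟩, b, y⟩ ⟨⟨a', x'⟩, b', y'⟩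
  simp [splitFirst, shift, withCatalyst, Fin.consEquiv]

theorem shift_prodOp {m : ℕ} (ρ : Matrix (A × B) (A × B) ℂ)
    (r : Fin (m + 1) → Matrix (A × B) (A × B) ℂ) :
    shift ρ (prodOp r) = (r (Fin.last m)).trace •
      prodOp (Fin.cons ρ (Fin.init r) : Fin (m + 1) → Matrix (A × B) (A × B) ℂ) := by
  ext x y
  simp only [shift, LinearMap.coe_mk, AddHom.coe_mk, splitLast_prodOp, traceSystem_withCatalyst]
  simp [prodOp, Fin.prod_univ_succ, Fin.tail, mul_left_comm]

/-- Each shift pushes the copies of `ρ` one place further; the discarded factors survive only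
through the scalar. -/
theorem shift_pow_prodOp {m : ℕ} (ρ : Matrix (A × B) (A × B) ℂ)
    (r : Fin (m + 1) → Matrix (A × B) (A × B) ℂ) (k : ℕ) :
    ∃ (c : ℂ) (r' : Fin (m + 1) → Matrix (A × B) (A × B) ℂ),
      (shift ρ ^ k) (prodOp r) = c • prodOp r' ∧ ∀ i : Fin (m + 1), (i : ℕ) < k → r' i = ρ := by
  induction k with
  | zero => exact ⟨1, r, by simp, by simp⟩
  | succ k ih =>
    obtain ⟨c, r', h, hr'⟩ := ih
    refine ⟨c * (r' (Fin.last m)).trace, Fin.cons ρ (Fin.init r'), ?_, fun i hi => ?_⟩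
    · rw [pow_succ', Module.End.mul_apply, h, map_smul, shift_prodOp, smul_smul]
    · induction i using Fin.cases with
      | zero => rfl
      | succ i =>
        rw [Fin.cons_succ]
        exact hr' _ (by simpa using hi)

theorem trace_shift {m : ℕ} {ρ : Matrix (A × B) (A × B) ℂ} (hρ : IsDensityMatrix ρ)
    (X : Matrix ((Fin (m + 1) → A) × (Fin (m + 1) → B))
      ((Fin (m + 1) → A) × (Fin (m + 1) → B)) ℂ) :
    (shift ρ X).trace = X.trace := by
  rw [← trace_splitFirst, splitFirst_shift, trace_withCatalyst, hρ.2, one_mul, trace_traceSystem,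
    trace_splitLast]

theorem posSemidef_shift {m : ℕ} {ρ : Matrix (A × B) (A × B) ℂ} (hρ : IsDensityMatrix ρ)
    {X : Matrix ((Fin (m + 1) → A) × (Fin (m + 1) → B))
      ((Fin (m + 1) → A) × (Fin (m + 1) → B)) ℂ} (hX : X.PosSemidef) :
    (shift ρ X).PosSemidef := by
  rw [← posSemidef_splitFirst_iff, splitFirst_shift]
  exact posSemidef_withCatalyst hρ.1 (posSemidef_traceSystem (hX.submatrix _))

theorem shift_pow_posSemidef_and_trace {m : ℕ} {ρ : Matrix (A × B) (A × B) ℂ}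
    (hρ : IsDensityMatrix ρ) (k : ℕ) {X : Matrix ((Fin (m + 1) → A) × (Fin (m + 1) → B))
      ((Fin (m + 1) → A) × (Fin (m + 1) → B)) ℂ} (hX : X.PosSemidef) :
    ((shift ρ ^ k) X).PosSemidef ∧ ((shift ρ ^ k) X).trace = X.trace := by
  induction k with
  | zero => exact ⟨hX, rfl⟩
  | succ k ih =>
    rw [pow_succ', Module.End.mul_apply]
    exact ⟨posSemidef_shift hρ ih.1, (trace_shift hρ _).trans ih.2⟩

theorem trace_prodOp {n : ℕ} (r : Fin n → Matrix (A × B) (A × B) ℂ) :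
    (prodOp r).trace = ∏ i, (r i).trace := by
  induction n with
  | zero => simp [prodOp, Matrix.trace]
  | succ n ih =>
    rw [← trace_splitLast, splitLast_prodOp, trace_withCatalyst, ih, Fin.prod_univ_castSucc,
      mul_comm]
    rfl

/-- After all copies have been replaced, nothing is left of the initial state. -/
theorem shift_pow_eq [DecidableEq A] [DecidableEq B] {m : ℕ} {ρ : Matrix (A × B) (A × B) ℂ}
    (hρ : IsDensityMatrix ρ) {X : Matrix ((Fin (m + 1) → A) × (Fin (m + 1) → B))
      ((Fin (m + 1) → A) × (Fin (m + 1) → B)) ℂ} (hX : IsDensityMatrix X) :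
    (shift ρ ^ (m + 1)) X = prodOp fun _ => ρ := by
  -- On matrix units the result is a multiple of the power of `ρ`. By linearity the same holds for
  -- `X`, and preservation of the trace fixes the multiple to be one.
  have h₁ : ∀ p q, ∃ c : ℂ, (shift ρ ^ (m + 1)) (Matrix.single p q (1 : ℂ)) =
      c • prodOp fun _ : Fin (m + 1) => ρ := by
    intro p q
    obtain ⟨c, r', h, hr'⟩ := shift_pow_prodOp ρ
      (fun i => Matrix.single (p.1 i, p.2 i) (q.1 i, q.2 i) (1 : ℂ)) (m + 1)
    refine ⟨c, ?_⟩
    rw [single_eq_prodOp, h, funext fun i => hr' i i.2]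
  choose c hc using h₁
  have h₂ : (shift ρ ^ (m + 1)) X =
      (∑ p, ∑ q, X p q * c p q) • prodOp fun _ : Fin (m + 1) => ρ := by
    conv_lhs => rw [matrix_eq_sum_single X]
    simp only [map_sum, Finset.sum_smul]
    refine Finset.sum_congr rfl fun p _ => Finset.sum_congr rfl fun q _ => ?_
    rw [← mul_one (X p q), ← smul_eq_mul, ← Matrix.smul_single, map_smul, hc, smul_smul]
    simp
  have h₃ := (shift_pow_posSemidef_and_trace hρ (m + 1) hX.1).2
  rw [h₂, trace_smul, trace_prodOp, hX.2] at h₃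
  simp only [hρ.2, Finset.prod_const_one, smul_eq_mul, mul_one] at h₃
  rw [h₂, h₃, one_smul]

/-- For `k ≤ m` the last copy has not been overwritten: it is still `σ`, uncorrelated with the
others. -/
theorem shift_pow_prodOp_const {m : ℕ} (ρ : Matrix (A × B) (A × B) ℂ)
    {σ : Matrix (A × B) (A × B) ℂ} (hσ : IsDensityMatrix σ) {k : ℕ} (hk : k ≤ m) :
    (shift ρ ^ k) (prodOp fun _ : Fin (m + 1) => σ) =
      prodOp fun i : Fin (m + 1) => if (i : ℕ) < k then ρ else σ := by
  induction k with
  | zero => simp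
  | succ k ih =>
    rw [pow_succ', Module.End.mul_apply, ih (by omega), shift_prodOp]
    rw [if_neg (by simp; omega), hσ.2, one_smul]
    congr 1
    ext1 i
    induction i using Fin.cases with
    | zero => simp
    | succ i => simp [Fin.init]

/-- An approximate transformation of many copies of `ρ` into many copies of `σ` yields a catalyst
for the transformation of a single copy. -/
theorem exists_catalyst_of_prodOp [DecidableEq A] [DecidableEq B] {m : ℕ}
    {ρ σ : Matrix (A × B) (A × B) ℂ} (hρ : IsDensityMatrix ρ) (hσ : IsDensityMatrix σ)
    {Γ : Matrix ((Fin (m + 1) → A) × (Fin (m + 1) → B))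
      ((Fin (m + 1) → A) × (Fin (m + 1) → B)) ℂ} (hΓ : IsDensityMatrix Γ)
    (hconv : Convertible (prodOp fun _ : Fin (m + 1) => ρ) Γ) {c : ℝ}
    (hnear : TraceBound c (Γ - prodOp fun _ => σ)) :
    ∃ τ : Matrix ((Fin (m + 1) × (Fin m → A)) × (Fin m → B))
        ((Fin (m + 1) × (Fin m → A)) × (Fin m → B)) ℂ,
      IsDensityMatrix τ ∧ Catalyzes τ ρ σ (c + c) := by
  -- In stage `k` the last copy plays the system and the other `m` copies the catalyst. Adding a
  -- fresh `ρ` to the latter gives the next shift up to relabelling.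
  refine exists_catalyst_of_cycle (ω := fun k : Fin (m + 1) => splitLast ((shift ρ ^ (k : ℕ)) Γ))
    (fun k => ?_) (fun k => ?_) fun k => ?_
  · have := shift_pow_posSemidef_and_trace hρ (k : ℕ) hΓ.1
    exact IsDensityMatrix.splitLast ⟨this.1, this.2.trans hΓ.2⟩
  · rw [← splitFirst_shift, ← Module.End.mul_apply, ← pow_succ']
    refine (Convertible.of_splitFirst _).trans ?_
    -- Only the last stage needs the many-copy protocol: there all copies have become `ρ`, and the
    -- protocol restores `Γ`, which is stage zero.
    by_cases hk : k = Fin.last m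
    · subst hk
      rw [Fin.val_last, shift_pow_eq hρ hΓ, Fin.last_add_one]
      simpa using hconv.trans (.splitLast Γ)
    · rw [Fin.val_add_one_of_lt (Fin.lt_last_iff_ne_last.mpr hk)]
      exact .splitLast _
  -- For copies of `σ` in place of `Γ`, the stage is exactly a product. The error `c` enters twice,
  -- through the stage and through its catalyst marginal.
  · have hshift : TraceBound c ((shift ρ ^ (k : ℕ)) Γ - (shift ρ ^ (k : ℕ)) (prodOp fun _ => σ)) := by
      rw [← map_sub]
      exact hnear.map _ fun P hP => shift_pow_posSemidef_and_trace hρ k hP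
    have hsplit : TraceBound c (splitLast ((shift ρ ^ (k : ℕ)) Γ) -
        splitLast ((shift ρ ^ (k : ℕ)) (prodOp fun _ => σ))) := hshift.splitLast
    have hideal : splitLast ((shift ρ ^ (k : ℕ)) (prodOp fun _ : Fin (m + 1) => σ)) =
        withCatalyst σ (traceSystem (splitLast
          ((shift ρ ^ (k : ℕ)) (prodOp fun _ : Fin (m + 1) => σ)))) := by
      rw [shift_pow_prodOp_const ρ hσ (Nat.lt_succ_iff.mp k.2), splitLast_prodOp,
        traceSystem_withCatalyst, if_neg (by simp; omega), hσ.2, one_smul]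
    refine hsplit.trans ?_
    rw [hideal, ← withCatalyst_sub_right]
    refine TraceBound.withCatalyst_right ?_ hσ
    have := hsplit.sub_comm.traceSystem
    convert this using 1
    ext
    simp [traceSystem]

end Shift

/-! ### Combining catalysts -/

section Combine

variable {A B A' B' A'' B'' : Type} [Fintype A] [Fintype B] [Fintype A'] [Fintype B']

theorem Catalyzes.of_traceBound {τ : Matrix (A' × B') (A' × B') ℂ}
    {ρ σ σ' : Matrix (A × B) (A × B) ℂ} {c d : ℝ} (h : Catalyzes τ ρ σ c) (hτ : IsDensityMatrix τ)
    (h' : TraceBound d (σ - σ')) : Catalyzes τ ρ σ' (c + d) := by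
  obtain ⟨ω, hω, h₁, h₂⟩ := h
  refine ⟨ω, hω, h₁, h₂.trans ?_⟩
  rw [← withCatalyst_sub_left]
  exact h'.withCatalyst_left hτ

variable [DecidableEq A'] [DecidableEq B']

theorem Catalyzes.of_convertible {τ : Matrix (A' × B') (A' × B') ℂ}
    {ρ σ : Matrix (A × B) (A × B) ℂ} (h : Convertible ρ σ) (hσ : σ.trace = 1) :
    Catalyzes τ ρ σ 0 :=
  ⟨withCatalyst σ τ, h.withCatalyst τ, by rw [traceSystem_withCatalyst, hσ, one_smul],
    by simpa using TraceBound.zero⟩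

/-- The source is replaced by an exact conversion; a mere approximation would disturb the returned
catalyst. -/
theorem Catalyzes.of_convertible_source {τ : Matrix (A' × B') (A' × B') ℂ}
    {ρ' ρ σ : Matrix (A × B) (A × B) ℂ} {c : ℝ} (h : Catalyzes τ ρ σ c) (h' : Convertible ρ' ρ) :
    Catalyzes τ ρ' σ c := by
  obtain ⟨ω, hω, h⟩ := h
  exact ⟨ω, (h'.withCatalyst τ).trans hω, h⟩

theorem withCatalyst_assoc {A B A' B' A'' B'' : Type*} (X : Matrix (A × B) (A × B) ℂ)
    (Y : Matrix (A' × B') (A' × B') ℂ) (Z : Matrix (A'' × B'') (A'' × B'') ℂ) :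
    (withCatalyst (withCatalyst X Y) Z).submatrix
      (Prod.map (Equiv.prodAssoc A A' A'').symm (Equiv.prodAssoc B B' B'').symm)
      (Prod.map (Equiv.prodAssoc A A' A'').symm (Equiv.prodAssoc B B' B'').symm) =
    withCatalyst X (withCatalyst Y Z) := by
  ext ⟨⟨a, x, x'⟩, b, y, y'⟩ ⟨⟨c, z, z'⟩, d, w, w'⟩
  simp [withCatalyst, mul_assoc]

variable [DecidableEq A] [DecidableEq B] [Fintype A''] [DecidableEq A''] [Fintype B'']
  [DecidableEq B'']

theorem Catalyzes.relabel {τ : Matrix (A' × B') (A' × B') ℂ} {ρ σ : Matrix (A × B) (A × B) ℂ}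
    {c : ℝ} (h : Catalyzes τ ρ σ c) (e : A'' ≃ A') (f : B'' ≃ B') :
    Catalyzes (τ.submatrix (Prod.map e f) (Prod.map e f)) ρ σ c := by
  obtain ⟨ω, h₁, h₂, h₃⟩ := h
  have hprod : ∀ χ : Matrix (A × B) (A × B) ℂ,
      withCatalyst χ (τ.submatrix (Prod.map e f) (Prod.map e f)) =
        (withCatalyst χ τ).submatrix
          (Prod.map (Equiv.prodCongr (Equiv.refl A) e) (Equiv.prodCongr (Equiv.refl B) f))
          (Prod.map (Equiv.prodCongr (Equiv.refl A) e) (Equiv.prodCongr (Equiv.refl B) f)) := by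
    intro χ
    ext ⟨⟨a, x⟩, b, y⟩ ⟨⟨a', x'⟩, b', y'⟩
    simp [withCatalyst]
  refine ⟨ω.submatrix (Prod.map (Equiv.prodCongr (Equiv.refl A) e)
    (Equiv.prodCongr (Equiv.refl B) f)) (Prod.map (Equiv.prodCongr (Equiv.refl A) e)
    (Equiv.prodCongr (Equiv.refl B) f)), ?_, ?_, ?_⟩
  · refine Convertible.trans ?_ (h₁.trans (.relabel _ _ _))
    rw [hprod]
    convert Convertible.relabel (Equiv.prodCongr (Equiv.refl A) e).symm
      (Equiv.prodCongr (Equiv.refl B) f).symm _ using 1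
    ext
    simp [Prod.map]
  · rw [← h₂]
    ext
    simp [traceSystem, Prod.map]
  · rw [hprod]
    exact h₃.submatrix (Equiv.prodCongr (Equiv.prodCongr (Equiv.refl A) e)
      (Equiv.prodCongr (Equiv.refl B) f))

theorem Catalyzes.prod_left {τ : Matrix (A' × B') (A' × B') ℂ} {ρ σ : Matrix (A × B) (A × B) ℂ}
    {c : ℝ} (h : Catalyzes τ ρ σ c) {τ' : Matrix (A'' × B'') (A'' × B'') ℂ}
    (hτ' : IsDensityMatrix τ') : Catalyzes (withCatalyst τ τ') ρ σ c := by
  obtain ⟨ω, h₁, h₂, h₃⟩ := h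
  refine ⟨(withCatalyst ω τ').submatrix
    (Prod.map (Equiv.prodAssoc A A' A'').symm (Equiv.prodAssoc B B' B'').symm)
    (Prod.map (Equiv.prodAssoc A A' A'').symm (Equiv.prodAssoc B B' B'').symm), ?_, ?_, ?_⟩
  · refine Convertible.trans ?_ ((h₁.withCatalyst τ').trans (.relabel _ _ _))
    rw [← withCatalyst_assoc]
    convert Convertible.relabel (Equiv.prodAssoc A A' A'') (Equiv.prodAssoc B B' B'') _ using 1
    ext
    simp [Prod.map]
  · rw [← h₂]
    ext
    simp [traceSystem, withCatalyst, Finset.sum_mul]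
  · rw [← withCatalyst_assoc]
    have := (h₃.withCatalyst_left hτ').submatrix
      (Equiv.prodCongr (Equiv.prodAssoc A A' A'').symm (Equiv.prodAssoc B B' B'').symm)
    rwa [withCatalyst_sub_left] at this

theorem Catalyzes.prod_right {τ : Matrix (A' × B') (A' × B') ℂ} {ρ σ : Matrix (A × B) (A × B) ℂ}
    {c : ℝ} (h : Catalyzes τ ρ σ c) {τ' : Matrix (A'' × B'') (A'' × B'') ℂ}
    (hτ' : IsDensityMatrix τ') : Catalyzes (withCatalyst τ' τ) ρ σ c := by
  convert (h.prod_left hτ').relabel (Equiv.prodComm A'' A') (Equiv.prodComm B'' B') using 1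
  ext
  simp [withCatalyst, mul_comm]

end Combine

/-- Finitely many transformations that can be catalyzed individually have a common catalyst. -/
theorem exists_common_catalyst {ι A B : Type} [Fintype A] [DecidableEq A] [Fintype B]
    [DecidableEq B] (s : Finset ι) (ρ σ : ι → Matrix (A × B) (A × B) ℂ) (c : ℝ)
    (h : ∀ i ∈ s, ∃ (A' B' : Type) (_ : Fintype A') (_ : DecidableEq A') (_ : Fintype B')
      (_ : DecidableEq B') (τ : Matrix (A' × B') (A' × B') ℂ),
      IsDensityMatrix τ ∧ Catalyzes τ (ρ i) (σ i) c) :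
    ∃ (A' B' : Type) (_ : Fintype A') (_ : DecidableEq A') (_ : Fintype B')
      (_ : DecidableEq B') (τ : Matrix (A' × B') (A' × B') ℂ),
      IsDensityMatrix τ ∧ ∀ i ∈ s, Catalyzes τ (ρ i) (σ i) c := by
  classical
  induction s using Finset.induction_on with
  | empty =>
    exact ⟨Unit, Unit, inferInstance, inferInstance, inferInstance, inferInstance, 1,
      ⟨.one, by simp⟩, by simp⟩
  | insert i s hi ih =>
    obtain ⟨A₁, B₁, _, _, _, _, τ₁, hτ₁, h₁⟩ := ih fun j hj => h j (by simp [hj])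
    obtain ⟨A₂, B₂, _, _, _, _, τ₂, hτ₂, h₂⟩ := h i (by simp)
    -- Each transformation uses its own tensor factor and leaves the other one idle.
    refine ⟨A₁ × A₂, B₁ × B₂, inferInstance, inferInstance, inferInstance, inferInstance,
      withCatalyst τ₁ τ₂, hτ₁.withCatalyst hτ₂, fun j hj => ?_⟩
    rcases Finset.mem_insert.mp hj with rfl | hj
    · exact h₂.prod_right hτ₁
    · exact (h₁ j hj).prod_left hτ₂

/-! ### State vectors -/

/-- The amplitudes of a bipartite state vector, as a matrix. -/
def amplitudes {A B : Type*} (ψ : EuclideanSpace ℂ (A × B)) : Matrix A B ℂ :=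
  Matrix.of fun a b => ψ (a, b)

section Vectors

variable {A B : Type} [Fintype A] [Fintype B]

theorem pureOp_amplitudes {A B : Type*} (ψ : EuclideanSpace ℂ (A × B)) :
    pureOp (amplitudes ψ) = ketBra ψ := rfl

theorem reduceA_ketBra {A B : Type*} [Fintype B] (ψ : EuclideanSpace ℂ (A × B)) :
    reduceA (ketBra ψ) = amplitudes ψ * (amplitudes ψ)ᴴ := by
  ext
  simp [reduceA, ketBra, amplitudes, Matrix.mul_apply]

theorem exists_amplitudes_eq {A B : Type*} (M : Matrix A B ℂ) :
    ∃ ψ : EuclideanSpace ℂ (A × B), amplitudes ψ = M :=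
  ⟨WithLp.toLp 2 fun p => M p.1 p.2, rfl⟩

theorem amplitudes_sub {A B : Type*} (ψ φ : EuclideanSpace ℂ (A × B)) :
    amplitudes (ψ - φ) = amplitudes ψ - amplitudes φ := rfl

theorem amplitudes_add {A B : Type*} (ψ φ : EuclideanSpace ℂ (A × B)) :
    amplitudes (ψ + φ) = amplitudes ψ + amplitudes φ := rfl

theorem trace_pureOp_amplitudes {A B : Type*} [Fintype A] [Fintype B]
    (ψ : EuclideanSpace ℂ (A × B)) : (pureOp (amplitudes ψ)).trace = ((‖ψ‖ ^ 2 : ℝ) : ℂ) := by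
  rw [EuclideanSpace.norm_sq_eq]
  simp [pureOp, amplitudes, Matrix.trace, Complex.mul_conj, Complex.normSq_eq_norm_sq]

theorem isDensityMatrix_ketBra {ψ : EuclideanSpace ℂ (A × B)} (h : ‖ψ‖ = 1) :
    IsDensityMatrix (ketBra ψ) :=
  ⟨posSemidef_pureOp (amplitudes ψ), by
    rw [← pureOp_amplitudes, trace_pureOp_amplitudes, h]; simp⟩

theorem traceBound_ketBra_sub {ψ φ : EuclideanSpace ℂ (A × B)} (hψ : ‖ψ‖ = 1) (hφ : ‖φ‖ = 1)
    {r : ℝ} (hr : 0 < r) (h : ‖ψ - φ‖ ≤ r) : TraceBound (r * 2) (ketBra ψ - ketBra φ) := by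
  rw [← pureOp_amplitudes, ← pureOp_amplitudes]
  refine TraceBound.pureOp_sub hr two_pos ?_ ?_
  · rw [← amplitudes_sub, trace_pureOp_amplitudes, Complex.ofReal_re]
    gcongr
  · rw [← amplitudes_add, trace_pureOp_amplitudes, Complex.ofReal_re]
    have := norm_add_le ψ φ
    gcongr
    linarith

variable [DecidableEq A]

theorem norm_sq_eq_sum_weights {ψ : EuclideanSpace ℂ (A × B)} {U : Matrix A A ℂ} {a : A → ℝ}
    (h : HasSchmidtWeights (amplitudes ψ) U a) : ‖ψ‖ ^ 2 = ∑ i, a i := by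
  have := (trace_pureOp_amplitudes ψ).symm.trans h.trace
  exact_mod_cast this

theorem entanglementEntropy_mul_log_two {ψ : EuclideanSpace ℂ (A × B)} {U : Matrix A A ℂ}
    {a : A → ℝ} (h : HasSchmidtWeights (amplitudes ψ) U a) :
    entanglementEntropy ψ * Real.log 2 = shannonEntropy a := by
  unfold entanglementEntropy vonNeumannEntropy
  rw [sum_eigenvalues_eq _ h.1 ((reduceA_ketBra ψ).trans h.2) fun x => x * Real.logb 2 x,
    shannonEntropy, neg_mul, Finset.sum_mul, ← Finset.sum_neg_distrib]
  refine Finset.sum_congr rfl fun i _ => ?_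
  have : Real.log 2 ≠ 0 := (Real.log_pos one_lt_two).ne'
  rw [Real.logb, Real.negMulLog]
  field_simp

variable [DecidableEq B]

theorem exists_catalyst_of_entropy_lt [Nonempty A] [Nonempty B] {ψ φ : EuclideanSpace ℂ (A × B)}
    (hψ : ‖ψ‖ = 1) (hφ : ‖φ‖ = 1) (h : entanglementEntropy φ < entanglementEntropy ψ) {c : ℝ}
    (hc : 0 < c) :
    ∃ (A' B' : Type) (_ : Fintype A') (_ : DecidableEq A') (_ : Fintype B')
      (_ : DecidableEq B') (τ : Matrix (A' × B') (A' × B') ℂ),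
      IsDensityMatrix τ ∧ Catalyzes τ (ketBra ψ) (ketBra φ) c := by
  obtain ⟨U, hU⟩ := exists_hasSchmidtWeights (amplitudes ψ)
  obtain ⟨V, hV⟩ := exists_hasSchmidtWeights (amplitudes φ)
  have ha := (norm_sq_eq_sum_weights hU).symm.trans (by rw [hψ, one_pow])
  have hb := (norm_sq_eq_sum_weights hV).symm.trans (by rw [hφ, one_pow])
  have hab := mul_lt_mul_of_pos_right h (Real.log_pos one_lt_two)
  rw [entanglementEntropy_mul_log_two hU, entanglementEntropy_mul_log_two hV] at hab
  obtain ⟨m, Γ, hΓ, hΓ'⟩ := exists_convertible_tensorPow hU hV ha hb hab (half_pos hc)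
  have hpow : IsDensityMatrix (pureOp (tensorPow (m + 1) (amplitudes ψ))) :=
    ⟨posSemidef_pureOp _, by rw [(hU.pow _).trace, sum_prod_eq_one ha]; simp⟩
  rw [← prodOp_pureOp] at hΓ hΓ'
  obtain ⟨τ, hτ, h'⟩ := exists_catalyst_of_prodOp (isDensityMatrix_ketBra hψ)
    (isDensityMatrix_ketBra hφ) (hΓ.isDensityMatrix (by rwa [prodOp_pureOp])) hΓ hΓ'
  rw [add_halves] at h'
  exact ⟨_, _, inferInstance, inferInstance, inferInstance, inferInstance, τ, hτ, h'⟩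

end Vectors

/-! ### A finite net of source states -/

/-- Moving the weights to a grid of mesh `1 / K`, with all rounding errors added to a largest
weight, makes them more ordered. -/
theorem exists_grid_weights {A : Type*} [Fintype A] [DecidableEq A] {a : A → ℝ}
    (ha0 : ∀ i, 0 ≤ a i) (ha : ∑ i, a i = 1) {K : ℕ} (hK : 0 < K) :
    ∃ g : A → Fin (K + 1), ∑ i, ((g i : ℕ) : ℝ) / K = 1 ∧
      (∀ i, |((g i : ℕ) : ℝ) / K - a i| ≤ Fintype.card A / K) ∧
      (∀ i, a i = 0 → ((g i : ℕ) : ℝ) / K = 0) ∧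
      ∃ (p : A → ℝ) (π : A → Equiv.Perm A), (∀ k, 0 ≤ p k) ∧ ∑ k, p k = 1 ∧
        ∀ i, a i = ∑ k, p k * (((g (π k i) : ℕ) : ℝ) / K) := by
  have hK' : (0 : ℝ) < K := by exact_mod_cast hK
  have hne : Nonempty A := by
    by_contra h
    rw [not_nonempty_iff] at h
    simp at ha
  obtain ⟨m, hm⟩ := Finite.exists_max a
  set s := Finset.univ.erase m with hs
  have hsplit : ∀ f : A → ℝ, ∑ i, f i = f m + ∑ i ∈ s, f i := fun f =>
    (Finset.add_sum_erase _ _ (Finset.mem_univ m)).symm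
  set F : A → ℕ := fun i => ⌊K * a i⌋₊ with hF
  have hFle : ∀ i, (F i : ℝ) ≤ K * a i := fun i =>
    Nat.floor_le (mul_nonneg hK'.le (ha0 i))
  have hFlt : ∀ i, K * a i < F i + 1 := fun i => Nat.lt_floor_add_one _
  have hsumF : ∑ i ∈ s, F i ≤ K := by
    have : ((∑ i ∈ s, F i : ℕ) : ℝ) ≤ K := by
      push_cast
      calc ∑ i ∈ s, (F i : ℝ) ≤ ∑ i ∈ s, K * a i := Finset.sum_le_sum fun i _ => hFle i
        _ ≤ ∑ i, K * a i := Finset.sum_le_univ_sum_of_nonneg fun i => mul_nonneg hK'.le (ha0 i)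
        _ = K := by rw [← Finset.mul_sum, ha, mul_one]
    exact_mod_cast this
  -- The largest weight receives the remainder, so the numerators add up to exactly `K`.
  set G : A → ℕ := fun i => if i = m then K - ∑ j ∈ s, F j else F i with hG
  have hGm : (G m : ℝ) = K - ∑ j ∈ s, (F j : ℝ) := by
    simp only [hG, if_true]
    rw [Nat.cast_sub hsumF]
    push_cast
    rfl
  have hGi : ∀ i ∈ s, G i = F i := fun i hi => if_neg (Finset.ne_of_mem_erase hi)
  have hGK : ∀ i, G i < K + 1 := by
    intro i
    by_cases hi : i = m
    · simp only [hG, hi, if_true]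
      omega
    · have hi' : i ∈ s := Finset.mem_erase.mpr ⟨hi, Finset.mem_univ i⟩
      rw [hGi i hi']
      exact Nat.lt_succ_of_le ((Finset.single_le_sum (fun _ _ => Nat.zero_le _) hi').trans hsumF)
  set b : A → ℝ := fun i => (G i : ℝ) / K with hb
  set r : A → ℝ := fun i => a i - b i with hr
  have hr0 : ∀ i ∈ s, 0 ≤ r i := by
    intro i hi
    simp only [hr, hb, hGi i hi, sub_nonneg]
    rw [div_le_iff₀ hK', mul_comm]
    exact hFle i
  have hr1 : ∀ i ∈ s, r i ≤ 1 / K := by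
    intro i hi
    simp only [hr, hb, hGi i hi]
    rw [sub_le_iff_le_add, ← add_div, le_div_iff₀ hK', mul_comm]
    linarith [hFlt i]
  have hbsum : ∑ i, b i = 1 := by
    have : ∑ i ∈ s, b i = (∑ i ∈ s, (F i : ℝ)) / K := by
      rw [Finset.sum_div]
      exact Finset.sum_congr rfl fun i hi => by simp only [hb, hGi i hi]
    rw [hsplit, this]
    simp only [hb]
    rw [hGm, ← add_div, sub_add_cancel, div_self hK'.ne']
  set R := ∑ i ∈ s, r i with hR
  have hR0 : 0 ≤ R := Finset.sum_nonneg hr0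
  have hbm : b m = a m + R := by
    have h₁ := hsplit a
    have h₂ := hsplit b
    have h₃ : R = ∑ i ∈ s, a i - ∑ i ∈ s, b i := by rw [hR, ← Finset.sum_sub_distrib]
    linarith
  have hcard : (1 : ℝ) ≤ Fintype.card A := by exact_mod_cast Fintype.card_pos
  have hRle : R ≤ Fintype.card A / K := by
    calc R ≤ ∑ i ∈ s, (1 : ℝ) / K := Finset.sum_le_sum hr1
      _ ≤ ∑ i : A, (1 : ℝ) / K := Finset.sum_le_univ_sum_of_nonneg fun i => by positivity
      _ = _ := by simp [div_eq_mul_inv]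
  have hdiff : ∀ i ∈ s, r i + R ≤ b m - b i := by
    intro i hi
    have := hm i
    simp only [hr] at *
    linarith
  -- Swapping `m` and `i` with probability `t i` moves `t i * (b m - b i) = r i` from the largest
  -- weight back to `i`, which undoes the rounding.
  set t : A → ℝ := fun i => r i / (b m - b i) with ht
  have ht0 : ∀ i ∈ s, 0 ≤ t i := fun i hi =>
    div_nonneg (hr0 i hi) (by linarith [hdiff i hi, hr0 i hi])
  have htr : ∀ i ∈ s, t i * (b m - b i) = r i := by
    intro i hi
    by_cases h0 : b m - b i = 0
    · have : r i = 0 := le_antisymm (by linarith [hdiff i hi]) (hr0 i hi)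
      rw [h0, this, mul_zero]
    · exact div_mul_cancel₀ _ h0
  -- Since `a m` is largest, `b m - b i ≥ R`, so the `t i` are at most the fractions `r i / R` of
  -- the total rounding error.
  have htsum : ∑ i ∈ s, t i ≤ 1 := by
    rcases hR0.eq_or_lt with h | h
    · have : ∀ i ∈ s, t i = 0 := by
        intro i hi
        have := (Finset.sum_eq_zero_iff_of_nonneg hr0).mp h.symm i hi
        simp [ht, this]
      rw [Finset.sum_congr rfl this]
      simp
    · calc ∑ i ∈ s, t i ≤ ∑ i ∈ s, r i / R := by
            refine Finset.sum_le_sum fun i hi => ?_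
            exact div_le_div_of_nonneg_left (hr0 i hi) h (by linarith [hdiff i hi, hr0 i hi])
        _ = 1 := by rw [← Finset.sum_div, div_self h.ne']
  refine ⟨fun i => ⟨G i, hGK i⟩, hbsum, fun i => ?_, fun i hi => ?_, ?_⟩
  · by_cases hi : i = m
    · subst hi
      change |b i - a i| ≤ _
      rw [hbm, add_sub_cancel_left, abs_of_nonneg hR0]
      exact hRle
    · have hi' : i ∈ s := Finset.mem_erase.mpr ⟨hi, Finset.mem_univ i⟩
      change |b i - a i| ≤ _
      rw [abs_sub_comm, abs_of_nonneg (hr0 i hi')]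
      exact (hr1 i hi').trans (by gcongr)
  · have him : i ≠ m := by
      rintro rfl
      have : ∑ j, a j = 0 := Finset.sum_eq_zero fun j _ => le_antisymm (hi ▸ hm j) (ha0 j)
      linarith
    simp [hG, him, hF, hi]
  · set p : A → ℝ := fun k => if k = m then 1 - ∑ i ∈ s, t i else t k with hp
    have hpm : p m = 1 - ∑ i ∈ s, t i := if_pos rfl
    have hps : ∀ k ∈ s, p k = t k := fun k hk => if_neg (Finset.ne_of_mem_erase hk)
    refine ⟨p, fun k => Equiv.swap m k, fun k => ?_, ?_, fun i => ?_⟩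
    · by_cases hk : k = m
      · rw [hk, hpm]
        linarith
      · have hk' : k ∈ s := Finset.mem_erase.mpr ⟨hk, Finset.mem_univ k⟩
        rw [hps k hk']
        exact ht0 k hk'
    · rw [hsplit, hpm, Finset.sum_congr rfl hps]
      ring
    · change a i = ∑ k, p k * b (Equiv.swap m k i)
      rw [hsplit, hpm, Finset.sum_congr rfl fun k hk => congrArg (· * _) (hps k hk),
        Equiv.swap_self, Equiv.refl_apply]
      by_cases hi : i = m
      · subst hi
        simp only [Equiv.swap_apply_left]
        have : ∑ k ∈ s, t k * b k = (∑ k ∈ s, t k) * b i - R := by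
          rw [hR, Finset.sum_mul, ← Finset.sum_sub_distrib]
          exact Finset.sum_congr rfl fun k hk => by linarith [htr k hk]
        rw [this, hbm]
        ring
      · have hi' : i ∈ s := Finset.mem_erase.mpr ⟨hi, Finset.mem_univ i⟩
        have : ∑ k ∈ s, t k * b (Equiv.swap m k i) = (∑ k ∈ s, t k) * b i + t i * (b m - b i) := by
          rw [← Finset.add_sum_erase s _ hi', ← Finset.add_sum_erase s t hi',
            Equiv.swap_apply_right, Finset.sum_congr rfl fun k hk => by
              rw [Equiv.swap_apply_of_ne_of_ne hi (Finset.ne_of_mem_erase hk).symm],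
            ← Finset.sum_mul]
          ring
        rw [this, htr i hi']
        simp only [hr]
        ring

/-- Changing the Schmidt weights of a vector, but not its Schmidt bases. -/
theorem HasSchmidtWeights.exists_reweighted {A B : Type} [Fintype A] [DecidableEq A] [Fintype B]
    {φ : EuclideanSpace ℂ (A × B)} {U : Matrix A A ℂ} {a b : A → ℝ}
    (hU : HasSchmidtWeights (amplitudes φ) U a) (hb : ∀ i, 0 ≤ b i)
    (hab : ∀ i, a i = 0 → b i = 0) :
    ∃ φ' : EuclideanSpace ℂ (A × B), HasSchmidtWeights (amplitudes φ') U b ∧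
      ‖φ' - φ‖ ^ 2 ≤ ∑ i, |b i - a i| := by
  set c : A → ℝ := fun i => √(b i / a i) with hc
  have hsq : ∀ i, c i ^ 2 * a i = b i := by
    intro i
    rw [Real.sq_sqrt (div_nonneg (hb i) (hU.nonneg i))]
    by_cases h0 : a i = 0
    · rw [h0, hab i h0, mul_zero]
    · exact div_mul_cancel₀ _ h0
  obtain ⟨φ', hφ'⟩ := exists_amplitudes_eq
    (U * diagonal (fun i => (c i : ℂ)) * Uᴴ * amplitudes φ)
  refine ⟨φ', ?_, ?_⟩
  · rw [hφ']
    convert hU.filter c using 2 with i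
    exact (hsq i).symm
  · have hdiff : HasSchmidtWeights (amplitudes (φ' - φ)) U fun i => (c i + -1) ^ 2 * a i := by
      have : amplitudes (φ' - φ) = U * diagonal (fun i => ((c i + -1 : ℝ) : ℂ)) * Uᴴ *
          amplitudes φ := by
        rw [amplitudes_sub, hφ', ← filter_add_smul hU.1]
        simp [sub_eq_add_neg]
      rw [this]
      exact hU.filter _
    rw [norm_sq_eq_sum_weights hdiff]
    refine Finset.sum_le_sum fun i _ => ?_
    have h0 := hU.nonneg i
    have hc0 : 0 ≤ c i := Real.sqrt_nonneg _
    -- This factors `c ^ 2 - 1`; the claim reduces to `|c - 1| ≤ c + 1`, that is, `(√b - √a) ^ 2 ≤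
    -- |b - a|`.
    have : |b i - a i| = |c i + -1| * (c i + 1) * a i := by
      rw [← hsq i, ← abs_of_nonneg (show 0 ≤ c i + 1 by linarith), ← abs_mul]
      nth_rewrite 3 [← abs_of_nonneg h0]
      rw [← abs_mul]
      congr 1
      ring
    rw [this, ← sq_abs, sq]
    gcongr
    rw [abs_le]
    constructor <;> linarith

theorem exists_uniform_modulus_negMulLog {δ : ℝ} (hδ : 0 < δ) :
    ∃ r > 0, ∀ x ∈ Set.Icc (0 : ℝ) 1, ∀ y ∈ Set.Icc (0 : ℝ) 1, |x - y| < r →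
      |Real.negMulLog x - Real.negMulLog y| < δ := by
  have := Metric.uniformContinuousOn_iff.mp (isCompact_Icc.uniformContinuousOn_of_continuous
    (Real.continuous_negMulLog.continuousOn (s := Set.Icc (0 : ℝ) 1))) δ hδ
  simpa only [Real.dist_eq] using this

/-- One vector per grid point suffices: a vector converts into any vector whose Schmidt weights are
its own weights rounded as in `exists_grid_weights`. Uniform continuity of `Real.negMulLog` bounds
the entropy loss. -/
theorem exists_source_net (A B : Type) [Fintype A] [DecidableEq A] [Fintype B] [DecidableEq B]
    [Nonempty A] [Nonempty B] {δ : ℝ} (hδ : 0 < δ) :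
    ∃ s : Finset (EuclideanSpace ℂ (A × B)), ∀ ψ : EuclideanSpace ℂ (A × B), ‖ψ‖ = 1 →
      ∃ ψ' ∈ s, ‖ψ'‖ = 1 ∧ entanglementEntropy ψ - δ ≤ entanglementEntropy ψ' ∧
        Convertible (ketBra ψ) (ketBra ψ') := by
  classical
  have hlog : 0 < Real.log 2 := Real.log_pos one_lt_two
  have hcard : (0 : ℝ) < Fintype.card A := by exact_mod_cast Fintype.card_pos
  obtain ⟨r, hr, hmod⟩ := exists_uniform_modulus_negMulLog
    (δ := δ * Real.log 2 / Fintype.card A) (by positivity)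
  obtain ⟨K, hK⟩ := exists_nat_gt (Fintype.card A / r)
  have hK' : (0 : ℝ) < K := lt_trans (by positivity) hK
  have hK0 : 0 < K := by exact_mod_cast hK'
  have hKr : Fintype.card A / K < r := by
    rw [div_lt_iff₀ hr] at hK
    rwa [div_lt_iff₀ hK', mul_comm]
  let P : (A → Fin (K + 1)) → EuclideanSpace ℂ (A × B) → Prop := fun g ψ =>
    ∃ U, HasSchmidtWeights (amplitudes ψ) U fun i => ((g i : ℕ) : ℝ) / K
  -- The default `0` is taken where `B` is too small for that many nonzero weights. Below,
  -- reweighting `ψ` itself shows that the grid point in use has a representative.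
  let rep : (A → Fin (K + 1)) → EuclideanSpace ℂ (A × B) := fun g =>
    if h : ∃ ψ, P g ψ then h.choose else 0
  refine ⟨Finset.univ.image rep, fun ψ hψ => ?_⟩
  obtain ⟨U, hU⟩ := exists_hasSchmidtWeights (amplitudes ψ)
  set a := (isHermitian_mul_conjTranspose_self (amplitudes ψ)).eigenvalues
  have ha : ∑ i, a i = 1 := (norm_sq_eq_sum_weights hU).symm.trans (by rw [hψ, one_pow])
  obtain ⟨g, hg, hgnear, hg0, p, π, hp0, hp1, hmix⟩ := exists_grid_weights hU.nonneg ha hK0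
  have hex : ∃ ψ, P g ψ := by
    obtain ⟨ψ', hψ', -⟩ := hU.exists_reweighted (b := fun i => ((g i : ℕ) : ℝ) / K)
      (fun i => by positivity) hg0
    exact ⟨ψ', U, hψ'⟩
  have hrep : P g (rep g) := by
    have h : rep g = hex.choose := dif_pos hex
    rw [h]
    exact hex.choose_spec
  obtain ⟨V, hV⟩ := hrep
  refine ⟨rep g, Finset.mem_image_of_mem _ (Finset.mem_univ g), ?_, ?_, ?_⟩
  · have := norm_sq_eq_sum_weights hV
    rw [hg] at this
    exact (pow_eq_one_iff_of_nonneg (norm_nonneg _) two_ne_zero).mp this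
  · refine le_of_mul_le_mul_right ?_ hlog
    rw [sub_mul, entanglementEntropy_mul_log_two hU, entanglementEntropy_mul_log_two hV,
      sub_le_iff_le_add, ← sub_le_iff_le_add', shannonEntropy, shannonEntropy,
      ← Finset.sum_sub_distrib]
    have hle : ∀ {w : A → ℝ}, (∀ i, 0 ≤ w i) → ∑ i, w i = 1 → ∀ i, w i ∈ Set.Icc (0 : ℝ) 1 :=
      fun h0 h1 i => ⟨h0 i, h1 ▸ Finset.single_le_sum (fun j _ => h0 j) (Finset.mem_univ i)⟩
    calc _ ≤ ∑ i : A, δ * Real.log 2 / Fintype.card A := by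
          refine Finset.sum_le_sum fun i _ => (le_abs_self _).trans
            (hmod _ (hle hU.nonneg ha i) _ (hle hV.nonneg hg i) ?_).le
          rw [abs_sub_comm]
          exact (hgnear i).trans_lt hKr
      _ = δ * Real.log 2 := by
          simp only [Finset.sum_const, Finset.card_univ, nsmul_eq_mul]
          field_simp
  · have := Convertible.of_mixture hU hV p hp0 π hmix
    rwa [hp1, Complex.ofReal_one, one_smul] at this

/-! ### Continuity of the entropy -/

theorem trace_cfc {n : Type*} [Fintype n] [DecidableEq n] {X : Matrix n n ℂ} (hX : X.IsHermitian)
    (f : ℝ → ℝ) : (cfc f X).trace = ((∑ i, f (hX.eigenvalues i) : ℝ) : ℂ) := by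
  rw [hX.cfc_eq f, Matrix.IsHermitian.cfc, Unitary.conjStarAlgAut_apply, trace_mul_comm,
    ← mul_assoc, Unitary.coe_star_mul_self, one_mul, trace_diagonal]
  simp

open scoped Matrix.Norms.L2Operator in
-- The entropy is the trace of a continuous function of the marginal, whose spectrum stays in `[0,
-- 1]`; this avoids following individual eigenvalues.
theorem continuousOn_entanglementEntropy (A B : Type) [Fintype A] [DecidableEq A] [Fintype B]
    [DecidableEq B] :
    ContinuousOn (entanglementEntropy : EuclideanSpace ℂ (A × B) → ℝ) (Metric.sphere 0 1) := by
  have hrho : Continuous fun ψ : EuclideanSpace ℂ (A × B) => reduceA (ketBra ψ) := by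
    refine continuous_matrix fun i j => ?_
    simp only [reduceA, ketBra, of_apply]
    fun_prop
  have hent : ∀ ψ : EuclideanSpace ℂ (A × B), entanglementEntropy ψ =
      (cfc Real.negMulLog (reduceA (ketBra ψ))).trace.re / Real.log 2 := by
    intro ψ
    rw [trace_cfc (reduceA_ketBra_isHermitian ψ), Complex.ofReal_re, entanglementEntropy,
      vonNeumannEntropy, Finset.sum_div, ← Finset.sum_neg_distrib]
    refine Finset.sum_congr rfl fun i _ => ?_
    rw [Real.negMulLog, Real.logb]
    ring
  have hcfc : ContinuousOn (fun ψ : EuclideanSpace ℂ (A × B) =>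
      cfc Real.negMulLog (reduceA (ketBra ψ))) (Metric.sphere 0 1) := by
    refine ContinuousOn.cfc' (s := Set.Icc (0 : ℝ) 1) isCompact_Icc _ hrho.continuousOn
      (fun ψ hψ => ?_) (fun ψ _ => reduceA_ketBra_isHermitian ψ)
      Real.continuous_negMulLog.continuousOn
    rw [(reduceA_ketBra_isHermitian ψ).spectrum_real_eq_range_eigenvalues]
    rintro _ ⟨i, rfl⟩
    obtain ⟨U, hU⟩ := exists_hasSchmidtWeights (amplitudes ψ)
    have h1 := norm_sq_eq_sum_weights hU
    rw [mem_sphere_zero_iff_norm.mp hψ, one_pow] at h1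
    exact ⟨hU.nonneg i, h1 ▸ Finset.single_le_sum (fun j _ => hU.nonneg j) (Finset.mem_univ i)⟩
  refine ContinuousOn.congr ?_ fun ψ _ => hent ψ
  exact ((Complex.continuous_re.comp (continuous_id.matrix_trace)).comp_continuousOn hcfc).div_const _

/-! ### A finite net of target states -/

/-- A nontrivial perturbation of a weight vector decreases its entropy in one of the two
directions. -/
theorem shannonEntropy_add_lt_or_sub_lt {A : Type*} [Fintype A] {b d : A → ℝ}
    (hd : ∀ i, |d i| ≤ b i) (hd0 : ∃ i, d i ≠ 0) :
    shannonEntropy (b + d) < shannonEntropy b ∨ shannonEntropy (b - d) < shannonEntropy b := by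
  by_contra! h
  have hstrict : ∀ i, d i ≠ 0 → Real.negMulLog (b i + d i) + Real.negMulLog (b i - d i) <
      2 * Real.negMulLog (b i) := by
    intro i hi
    have hab := abs_le.mp (hd i)
    have := Real.strictConcaveOn_negMulLog.2
      (Set.mem_Ici.mpr (by linarith : 0 ≤ b i + d i))
      (Set.mem_Ici.mpr (by linarith : 0 ≤ b i - d i)) (fun h => hi (by linarith))
      (by norm_num : (0 : ℝ) < 1 / 2) (by norm_num : (0 : ℝ) < 1 / 2) (by norm_num)
    simp only [smul_eq_mul] at this
    rw [show 1 / 2 * (b i + d i) + 1 / 2 * (b i - d i) = b i by ring] at this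
    linarith
  have hle : ∀ i, Real.negMulLog (b i + d i) + Real.negMulLog (b i - d i) ≤
      2 * Real.negMulLog (b i) := by
    intro i
    by_cases hi : d i = 0
    · rw [hi, add_zero, sub_zero, two_mul]
    · exact (hstrict i hi).le
  obtain ⟨j, hj⟩ := hd0
  have hlt := Finset.sum_lt_sum (fun i _ => hle i) ⟨j, Finset.mem_univ j, hstrict j hj⟩
  rw [Finset.sum_add_distrib, ← Finset.mul_sum] at hlt
  simp only [shannonEntropy, Pi.add_apply, Pi.sub_apply] at h
  linarith

/-- Mass `s` is moved between `i` and `j`. Which direction lowers the entropy is not known in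
advance, so `s` must be bounded by both weights. -/
theorem exists_nearby_weights_of_pos {A : Type*} [Fintype A] [DecidableEq A] {b : A → ℝ}
    (hb : ∀ i, 0 ≤ b i) {i j : A} (hij : i ≠ j) (hi : 0 < b i) (hj : 0 < b j) {r : ℝ}
    (hr : 0 < r) :
    ∃ b' : A → ℝ, (∀ k, 0 ≤ b' k) ∧ ∑ k, b' k = ∑ k, b k ∧ (∀ k, b k = 0 → b' k = 0) ∧
      ∑ k, |b' k - b k| ≤ r ∧ shannonEntropy b' < shannonEntropy b := by
  obtain ⟨s, hs0, hsi, hsj, hsr⟩ : ∃ s : ℝ, 0 < s ∧ s ≤ b i ∧ s ≤ b j ∧ 2 * s ≤ r := by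
    refine ⟨min (min (b i) (b j)) (r / 2), by positivity,
      (min_le_left _ _).trans (min_le_left _ _), (min_le_left _ _).trans (min_le_right _ _), ?_⟩
    linarith [min_le_right (min (b i) (b j)) (r / 2)]
  set d : A → ℝ := Pi.single i s - Pi.single j s with hd
  have hdi : d i = s := by simp [hd, hij]
  have hdle : ∀ k, |d k| ≤ b k := by
    intro k
    by_cases hki : k = i
    · rw [hki, hdi, abs_of_pos hs0]
      exact hsi
    · by_cases hkj : k = j
      · subst hkj
        simpa [hd, hki, abs_of_pos hs0] using hsj
      · simpa [hd, hki, hkj] using hb k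
  have hdsum : ∑ k, d k = 0 := by simp [hd, Finset.sum_sub_distrib]
  have hdabs : ∑ k, |d k| ≤ r := by
    refine le_trans ?_ hsr
    calc ∑ k, |d k| ≤ ∑ k, (Pi.single i s k + Pi.single j s k) := by
          refine Finset.sum_le_sum fun k _ => ?_
          have h₁ : 0 ≤ (Pi.single i s : A → ℝ) k := by
            by_cases h : k = i <;> simp [h, hs0.le]
          have h₂ : 0 ≤ (Pi.single j s : A → ℝ) k := by
            by_cases h : k = j <;> simp [h, hs0.le]
          simp only [hd, Pi.sub_apply]
          rw [abs_le]
          constructor <;> linarith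
      _ = 2 * s := by simp [Finset.sum_add_distrib, two_mul]
  have hzero : ∀ k, b k = 0 → d k = 0 := fun k hk =>
    abs_eq_zero.mp (le_antisymm (hk ▸ hdle k) (abs_nonneg _))
  rcases shannonEntropy_add_lt_or_sub_lt hdle ⟨i, hdi ▸ hs0.ne'⟩ with h | h
  · refine ⟨b + d, fun k => ?_, ?_, fun k hk => ?_, ?_, h⟩
    · have := abs_le.mp (hdle k)
      simp only [Pi.add_apply]
      linarith
    · simp [Finset.sum_add_distrib, hdsum]
    · simp [hk, hzero k hk]
    · simpa using hdabs
  · refine ⟨b - d, fun k => ?_, ?_, fun k hk => ?_, ?_, h⟩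
    · have := abs_le.mp (hdle k)
      simp only [Pi.sub_apply]
      linarith
    · simp [Finset.sum_sub_distrib, hdsum]
    · simp [hk, hzero k hk]
    · simpa using hdabs

section

variable {A B : Type} [Fintype A] [DecidableEq A] [Fintype B] [DecidableEq B]

/-- A unit vector is either a product vector, hence reachable from every unit vector, or has
arbitrarily close unit vectors of smaller entropy. -/
theorem reachable_or_exists_nearby_lt [Nonempty A] [Nonempty B] {φ : EuclideanSpace ℂ (A × B)}
    (hφ : ‖φ‖ = 1) {r : ℝ} (hr : 0 < r) :
    (∀ ψ : EuclideanSpace ℂ (A × B), ‖ψ‖ = 1 → Convertible (ketBra ψ) (ketBra φ)) ∨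
      ∃ φ' : EuclideanSpace ℂ (A × B), ‖φ'‖ = 1 ∧ ‖φ' - φ‖ ≤ r ∧
        entanglementEntropy φ' < entanglementEntropy φ := by
  obtain ⟨V, hV⟩ := exists_hasSchmidtWeights (amplitudes φ)
  set b := (isHermitian_mul_conjTranspose_self (amplitudes φ)).eigenvalues
  have hb : ∑ i, b i = 1 := (norm_sq_eq_sum_weights hV).symm.trans (by rw [hφ, one_pow])
  by_cases h : ∃ i j, i ≠ j ∧ 0 < b i ∧ 0 < b j
  · right
    obtain ⟨i, j, hij, hi, hj⟩ := h
    obtain ⟨b', hb'0, hb'1, hb'b, hdist, hlt⟩ :=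
      exists_nearby_weights_of_pos hV.nonneg hij hi hj (pow_pos hr 2)
    obtain ⟨φ', hφ', hnear⟩ := hV.exists_reweighted hb'0 hb'b
    refine ⟨φ', ?_, ?_, ?_⟩
    · have := norm_sq_eq_sum_weights hφ'
      rw [hb'1, hb] at this
      exact (pow_eq_one_iff_of_nonneg (norm_nonneg _) two_ne_zero).mp this
    · exact (sq_le_sq₀ (norm_nonneg _) hr.le).mp (hnear.trans hdist)
    · refine lt_of_mul_lt_mul_right ?_ (Real.log_nonneg one_le_two)
      rwa [entanglementEntropy_mul_log_two hφ', entanglementEntropy_mul_log_two hV]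
  · left
    push Not at h
    obtain ⟨j, -, hj⟩ : ∃ j ∈ Finset.univ, 0 < b j := by
      refine Finset.exists_lt_of_sum_lt (f := fun _ => (0 : ℝ)) ?_
      simp [hb]
    have h0 : ∀ i, i ≠ j → b i = 0 := fun i hi =>
      le_antisymm (h j i hi.symm hj) (hV.nonneg i)
    have h1 : b j = 1 := by
      rw [← hb]
      exact (Finset.sum_eq_single j (fun i _ hi => h0 i hi) (by simp)).symm
    intro ψ hψ
    obtain ⟨U, hU⟩ := exists_hasSchmidtWeights (amplitudes ψ)
    have ha := (norm_sq_eq_sum_weights hU).symm.trans (by rw [hψ, one_pow])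
    -- Swapping `j` with `k` at probability `a k` spreads the point mass at `j` into the weights of
    -- `ψ`.
    have := Convertible.of_mixture hU hV _ hU.nonneg (fun k => Equiv.swap j k) fun i => by
      rw [Finset.sum_eq_single i]
      · rw [Equiv.swap_apply_right, h1, mul_one]
      · intro k _ hk
        rw [h0, mul_zero]
        intro h
        rw [Equiv.swap_apply_eq_iff, Equiv.swap_apply_left] at h
        exact hk h.symm
      · simp
    rwa [ha, Complex.ofReal_one, one_smul] at this

/-- Compactness of the sphere makes the entropy gap uniform: near each point a single `φ'` and a
single gap work, and finitely many neighbourhoods cover. -/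
theorem exists_target_net (A B : Type) [Fintype A] [DecidableEq A] [Fintype B] [DecidableEq B]
    [Nonempty A] [Nonempty B] {r : ℝ} (hr : 0 < r) :
    ∃ δ > 0, ∃ t : Finset (EuclideanSpace ℂ (A × B)), ∀ φ : EuclideanSpace ℂ (A × B), ‖φ‖ = 1 →
      ∃ φ' ∈ t, ‖φ'‖ = 1 ∧ ‖φ' - φ‖ ≤ r ∧
        ((∀ ψ : EuclideanSpace ℂ (A × B), ‖ψ‖ = 1 → Convertible (ketBra ψ) (ketBra φ')) ∨
          entanglementEntropy φ' + δ ≤ entanglementEntropy φ) := by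
  classical
  have key := (isCompact_sphere (0 : EuclideanSpace ℂ (A × B)) 1).induction_on
    (p := fun S => ∃ δ > 0, ∃ t : Finset (EuclideanSpace ℂ (A × B)), ∀ φ ∈ S,
      ∃ φ' ∈ t, ‖φ'‖ = 1 ∧ ‖φ' - φ‖ ≤ r ∧
        ((∀ ψ : EuclideanSpace ℂ (A × B), ‖ψ‖ = 1 → Convertible (ketBra ψ) (ketBra φ')) ∨
          entanglementEntropy φ' + δ ≤ entanglementEntropy φ)) ?_ ?_ ?_ ?_
  · obtain ⟨δ, hδ, t, h⟩ := key
    exact ⟨δ, hδ, t, fun φ hφ => h φ (mem_sphere_zero_iff_norm.mpr hφ)⟩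
  · exact ⟨1, one_pos, ∅, by simp⟩
  · rintro S T hST ⟨δ, hδ, t, h⟩
    exact ⟨δ, hδ, t, fun φ hφ => h φ (hST hφ)⟩
  · rintro S T ⟨δ, hδ, t, h⟩ ⟨δ', hδ', t', h'⟩
    refine ⟨min δ δ', lt_min hδ hδ', t ∪ t', ?_⟩
    rintro φ (hφ | hφ)
    · obtain ⟨φ', ht, h₁, h₂, h₃⟩ := h φ hφ
      exact ⟨φ', Finset.mem_union_left _ ht, h₁, h₂,
        h₃.imp_right fun h₃ => by linarith [min_le_left δ δ']⟩
    · obtain ⟨φ', ht, h₁, h₂, h₃⟩ := h' φ hφ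
      exact ⟨φ', Finset.mem_union_right _ ht, h₁, h₂,
        h₃.imp_right fun h₃ => by linarith [min_le_right δ δ']⟩
  · intro φ₀ hφ₀
    have hball : ∀ᶠ φ in nhdsWithin φ₀ (Metric.sphere 0 1), ‖φ₀ - φ‖ < r / 2 := by
      refine Filter.Eventually.filter_mono nhdsWithin_le_nhds ?_
      filter_upwards [Metric.ball_mem_nhds φ₀ (half_pos hr)] with φ hφ
      rwa [← dist_eq_norm, dist_comm]
    rcases reachable_or_exists_nearby_lt (mem_sphere_zero_iff_norm.mp hφ₀) (half_pos hr) with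
      h | ⟨φ', h₁, h₂, h₃⟩
    · refine ⟨_, hball, 1, one_pos, {φ₀}, fun φ hφ => ⟨φ₀, Finset.mem_singleton_self _,
        mem_sphere_zero_iff_norm.mp hφ₀, ?_, Or.inl h⟩⟩
      have : ‖φ₀ - φ‖ < r / 2 := hφ
      linarith
    -- By continuity of the entropy, half of the gap at `φ₀` persists nearby.
    · set g := entanglementEntropy φ₀ - entanglementEntropy φ' with hg
      have hg0 : 0 < g := sub_pos.mpr h₃
      have hcont := (continuousOn_entanglementEntropy A B φ₀ hφ₀).eventually
        (lt_mem_nhds (show entanglementEntropy φ' + g / 2 < entanglementEntropy φ₀ by linarith))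
      refine ⟨_, hball.and hcont, g / 2, half_pos hg0, {φ'}, fun φ hφ => ⟨φ',
        Finset.mem_singleton_self _, h₁, ?_, Or.inr ?_⟩⟩
      · have : ‖φ₀ - φ‖ < r / 2 := hφ.1
        calc ‖φ' - φ‖ = ‖(φ' - φ₀) + (φ₀ - φ)‖ := by rw [sub_add_sub_cancel]
          _ ≤ _ := norm_add_le _ _
          _ ≤ r := by linarith
      · exact le_of_lt hφ.2

/-- A catalyst for all pairs of unit vectors of a fixed bipartite space. -/
theorem exists_universal_catalyst (A B : Type) [Fintype A] [DecidableEq A] [Fintype B]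
    [DecidableEq B] [Nonempty A] [Nonempty B] {c : ℝ} (hc : 0 < c) :
    ∃ (A' B' : Type) (_ : Fintype A') (_ : DecidableEq A') (_ : Fintype B')
      (_ : DecidableEq B') (τ : Matrix (A' × B') (A' × B') ℂ),
      IsDensityMatrix τ ∧ ∀ ψ φ : EuclideanSpace ℂ (A × B), ‖ψ‖ = 1 → ‖φ‖ = 1 →
        entanglementEntropy φ ≤ entanglementEntropy ψ →
        Catalyzes τ (ketBra ψ) (ketBra φ) c := by
  classical
  -- The target net fixes `δ`, to which the source net is then adapted. Distance `c / 4` between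
  -- unit vectors costs `c / 2` in trace norm.
  obtain ⟨δ, hδ, t, ht⟩ := exists_target_net A B (r := c / 4) (by positivity)
  obtain ⟨s, hs⟩ := exists_source_net A B (half_pos hδ)
  obtain ⟨A', B', _, _, _, _, τ, hτ, hcat⟩ := exists_common_catalyst
    ((s ×ˢ t).filter fun q => ‖q.1‖ = 1 ∧ ‖q.2‖ = 1 ∧
      entanglementEntropy q.2 < entanglementEntropy q.1)
    (fun q => ketBra q.1) (fun q => ketBra q.2) (c / 2) fun q hq => by
      obtain ⟨-, h₁, h₂, h₃⟩ := Finset.mem_filter.mp hq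
      exact exists_catalyst_of_entropy_lt h₁ h₂ h₃ (half_pos hc)
  refine ⟨A', B', ‹_›, ‹_›, ‹_›, ‹_›, τ, hτ, fun ψ φ hψ hφ hle => ?_⟩
  obtain ⟨φ', hφ't, hφ', hnear, hor⟩ := ht φ hφ
  have hbound := traceBound_ketBra_sub hφ' hφ (by positivity) hnear
  have hhalf : c / 4 * 2 = c / 2 := by ring
  rw [hhalf] at hbound
  have hcat' : Catalyzes τ (ketBra ψ) (ketBra φ') (c / 2) := by
    rcases hor with h | h
    · obtain ⟨ω, h₁, h₂, h₃⟩ :=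
        Catalyzes.of_convertible (τ := τ) (h ψ hψ) (isDensityMatrix_ketBra hφ').2
      exact ⟨ω, h₁, h₂, h₃.mono (half_pos hc).le⟩
    · obtain ⟨ψ', hψ's, hψ', hent, hconv⟩ := hs ψ hψ
      refine (hcat (ψ', φ') (Finset.mem_filter.mpr ⟨Finset.mem_product.mpr ⟨hψ's, hφ't⟩,
        hψ', hφ', ?_⟩)).of_convertible_source hconv
      change entanglementEntropy φ' < entanglementEntropy ψ'
      -- The chain is `S(φ') + δ ≤ S(φ) ≤ S(ψ) ≤ S(ψ') + δ / 2`.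
      linarith
  have := hcat'.of_traceBound hτ hbound
  rwa [add_halves] at this

end

end UniversalCatalysis

end

theorem theorem1 (A B : Type) [Fintype A] [DecidableEq A] [Fintype B] [DecidableEq B]
    (ε : ℝ) (hε : 0 < ε) :
    ∃ (A' B' : Type) (_ : Fintype A') (_ : DecidableEq A') (_ : Fintype B') (_ : DecidableEq B')
      (τ : Matrix (A' × B') (A' × B') ℂ),
      UniversalCatalysis.IsDensityMatrix τ ∧
      ∀ ψ φ : EuclideanSpace ℂ (A × B), ‖ψ‖ = 1 → ‖φ‖ = 1 →
        UniversalCatalysis.entanglementEntropy φ ≤ UniversalCatalysis.entanglementEntropy ψ →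
        ∃ Λ : Matrix ((A × A') × (B × B')) ((A × A') × (B × B')) ℂ →ₗ[ℂ]
            Matrix ((A × A') × (B × B')) ((A × A') × (B × B')) ℂ,
          UniversalCatalysis.IsLOCC Λ ∧
          UniversalCatalysis.traceSystem
              (Λ (UniversalCatalysis.withCatalyst (UniversalCatalysis.ketBra ψ) τ)) = τ ∧
          UniversalCatalysis.traceNorm
              (Λ (UniversalCatalysis.withCatalyst (UniversalCatalysis.ketBra ψ) τ) -
                UniversalCatalysis.withCatalyst (UniversalCatalysis.ketBra φ) τ) < ε := by
  by_cases hne : Nonempty A ∧ Nonempty B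
  · obtain ⟨_, _⟩ := hne
    obtain ⟨A', B', _, _, _, _, τ, hτ, h⟩ :=
      UniversalCatalysis.exists_universal_catalyst A B (half_pos hε)
    refine ⟨A', B', ‹_›, ‹_›, ‹_›, ‹_›, τ, hτ, fun ψ φ hψ hφ hle => ?_⟩
    obtain ⟨_, ⟨Λ, hΛ, rfl⟩, h₁, h₂⟩ := h ψ φ hψ hφ hle
    exact ⟨Λ, hΛ, h₁, h₂.traceNorm_le.trans_lt (half_lt_self hε)⟩
  -- A zero-dimensional space has no unit vectors, so a trivial catalyst serves.
  · have hempty : IsEmpty (A × B) := by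
      rwa [← not_nonempty_iff, nonempty_prod]
    refine ⟨Unit, Unit, inferInstance, inferInstance, inferInstance, inferInstance, 1,
      ⟨Matrix.PosSemidef.one, by simp⟩, fun ψ φ hψ => ?_⟩
    rw [Subsingleton.elim ψ 0, norm_zero] at hψ
    exact absurd hψ zero_ne_one
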